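/- **Lemma 4 (Embedding Lemma).** Graphs are finite digraphs in which a node may carry a self-loop. Two distinct nodes $u,v$ are *connected* if at least one of the edges $(u,v),(v,u)$ is present. The degree of a node $u$ is the number of nodes connected to $u$ (so a double edge counts once and a self-loop is not counted), and $\deg(F)$ is the maximal degree of the nodes of $F$. A *di-embedding* of $F$ into $G$ is a one-to-one map $g:V(F)\to V(G)$ that is an isomorphism, loops included, on each two-node induced subgraph $F[\{u,v\}]$ with $u,v$ connected. $F$ and $G$ are *compatible* if they have the same number of looped nodes and the same number of un-looped nodes. Let $\omega:\mathbb N\to\mathbb R$ satisfy $\omega_n\to\infty$. For every $\varepsilon>0$ there is an $N$, depending only on $\omega$ and $\varepsilon$, such that the following holds. Let $F$ be a digraph on $n\ge N$ nodes, let $H$ be an induced subgraph of $F$ (possibly empty), and put $d=\deg(F)$. Suppose that $$|F-H|>2d^34^d+\omega_n,$$ and that, moreover, the number of looped nodes of $F-H$ and the number of un-looped nodes of $F-H$ are each either $0$ or greater than $2d^34^d+\omega_n$. Let $G$ be a random digraph on the node set $V(F)$, in which each ordered pair of nodes (loops included) is an edge independently with probability $1/2$, conditioned on the event that $G$ contains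 $H$ as an induced subgraph (that is, $G[V(H)]=H$) and is compatible with $F$. Then with probability at least $1-\varepsilon$ there is a di-embedding $g$ of $F$ into $G$ with $g(u)=u$ for all $u\in V(H)$. -/

import Mathlib

open MeasureTheory ProbabilityTheory Filter Topology

namespace DiEmbed

variable {V W : Type*}

/-- Two distinct nodes are connected when at least one of the edges `(u, v)`, `(v, u)` is present
(a single or a double edge). -/
def Connected (F : Digraph V) (u v : V) : Prop :=
  u ≠ v ∧ (F.Adj u v ∨ F.Adj v u)

/-- The degree of a node: the number of incident incoming, outgoing or double edges. A double edge
is one incident edge, and a self-loop is not counted. -/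
noncomputable def nodeDegree (F : Digraph V) (u : V) : ℕ :=
  {v | Connected F u v}.ncard

/-- The degree of a digraph: the maximal degree of its nodes. -/
noncomputable def degree [Fintype V] (F : Digraph V) : ℕ :=
  Finset.univ.sup (nodeDegree F)

/-- The set of looped nodes. -/
def looped (F : Digraph V) : Set V := {v | F.Adj v v}

/-- The set of un-looped nodes. -/
def unlooped (F : Digraph V) : Set V := {v | ¬ F.Adj v v}

/-- `F` has the same number of looped and the same number of un-looped nodes as `G`. -/
def Compatible (F : Digraph V) (G : Digraph W) : Prop :=
  (looped F).ncard = (looped G).ncard ∧ (unlooped F).ncard = (unlooped G).ncard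

/-- `F` and `G` induce the same subgraph on the node set `S`; that is, with `H` the subgraph of `F`
induced on `S`, the digraph `G` also contains `H` as an induced subgraph. Loops are included. -/
def SameInducedOn (S : Set V) (F G : Digraph V) : Prop :=
  ∀ u ∈ S, ∀ v ∈ S, (F.Adj u v ↔ G.Adj u v)

/-- A di-embedding of `F` into `G`: a one-to-one map of nodes which restricts to an isomorphism
(loops included) on each two-node induced subgraph of `F` whose nodes are connected. -/
structure IsDiEmbedding (F : Digraph V) (G : Digraph W) (g : V → W) : Prop where
  injective : Function.Injective g
  iso : ∀ u v, Connected F u v → ∀ x ∈ ({u, v} : Set V), ∀ y ∈ ({u, v} : Set V),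
    (F.Adj x y ↔ G.Adj (g x) (g y))

/-- The digraph (loops allowed) with a given table of edges. -/
def ofTable (a : V × V → Bool) : Digraph V where
  Adj u v := a (u, v) = true

/-- The law of the edge table of a random digraph on `V`: each of the ordered pairs, loops
included, is an edge independently with probability `1/2`. -/
noncomputable def edgeLaw (V : Type*) [Fintype V] : Measure (V × V → Bool) :=
  Measure.pi fun _ => (PMF.uniformOfFintype Bool).toMeasure

/-- The law of a random digraph `G` on the nodes of `F`, conditioned on containing the subgraph of
`F` induced on `S` as an induced subgraph and on being compatible with `F`. -/
noncomputable def condLaw [Fintype V] (F : Digraph V) (S : Set V) : Measure (V × V → Bool) :=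
  (edgeLaw V)[|{a | SameInducedOn S F (ofTable a) ∧ Compatible F (ofTable a)}]

end DiEmbed

/-!
Join two nodes outside `S` when they are connected in `F` or have a common neighbour. This conflict
graph has maximal degree at most `d ^ 2`, so the Hajnal–Szemerédi theorem, applied to the looped
and to the un-looped nodes separately, splits the nodes outside `S` into levels, each free of
conflicts, of constant loop status, and of size at least a `1 / (d ^ 2 + 1)` fraction of all nodes
of that loop status. The levels are embedded one after another, each onto its own node set. When a
level of size `k` is reached, placing `x` at `y` is allowed or not by the at most `2 * d` edges
between `y` and the images of the embedded neighbours of `x`. Freedom from conflicts makes these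
edge sets disjoint, so the `k * k` candidate pairs are independent, each of probability at least
`4⁻¹ ^ d`, and Hall's theorem gives a perfect matching with high probability. A matching is likely
once `k / 4 ^ d` exceeds `log k`, and `2 * d ^ 3 * 4 ^ d / (d ^ 2 + 1)` is about `2 * d * 4 ^ d`,
which beats `d * log 4`. Compatibility enters only through the loops: a relabelling of the nodes
outside `S` turns the loops of `G` into those of `F`.
-/

namespace DiEmbed

open scoped Finset

section HajnalSzemeredi

variable {U ι : Type*} {G : SimpleGraph U}

/-- `x` has no neighbour of colour `i`, so that it may be recoloured `i`. -/
def IsFree (C : G.Coloring ι) (x : U) (i : ι) : Prop :=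
  ∀ w, C w = i → ¬ G.Adj x w

section Recolor

variable {H : SimpleGraph U}

open Classical in
/-- The colouring obtained by giving the vertex `x` the colour `i`. Edges at `x` may be missing
from the graph `H` that is coloured beforehand. -/
noncomputable def recolor (C : H.Coloring ι) (x : U) (i : ι)
    (hG : ∀ u v, u ≠ x → v ≠ x → G.Adj u v → H.Adj u v)
    (hi : ∀ w, w ≠ x → C w = i → ¬ G.Adj x w) : G.Coloring ι :=
  SimpleGraph.Coloring.mk (Function.update C x i) fun {u v} huv => by
    by_cases hu : u = x
    · have hv : v ≠ x := fun hv => huv.ne (hu.trans hv.symm)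
      rw [hu, Function.update_self, Function.update_of_ne hv]
      exact fun h => hi v hv h.symm (hu ▸ huv)
    · rw [Function.update_of_ne hu]
      by_cases hv : v = x
      · rw [hv, Function.update_self]
        exact fun h => hi u hu h (hv ▸ huv.symm)
      · rw [Function.update_of_ne hv]
        exact C.valid (hG u v hu hv huv)

variable {C : H.Coloring ι} {x : U} {i : ι} {hG : ∀ u v, u ≠ x → v ≠ x → G.Adj u v → H.Adj u v}
  {hi : ∀ w, w ≠ x → C w = i → ¬ G.Adj x w}

theorem recolor_self : recolor C x i hG hi x = i := by
  classical
  exact Function.update_self x i C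

theorem recolor_of_ne {v : U} (hv : v ≠ x) : recolor C x i hG hi v = C v := by
  classical
  exact Function.update_of_ne hv i C

end Recolor

section Route

variable {C C' : G.Coloring ι} {a : ι}

open Classical in
/-- `Route C a P X`: the colours in `P` form a simple path from `X` to `a` such that each class
along the path has a vertex that may be moved to the next one. -/
inductive Route (C : G.Coloring ι) (a : ι) : Finset ι → ι → Prop
  | sink : Route C a {a} a
  | step {P : Finset ι} {x : U} {Y : ι} (hx : C x ∉ P) (hP : Route C a P Y) (hf : IsFree C x Y) :
      Route C a (insert (C x) P) (C x)

theorem Route.mem {P : Finset ι} {X : ι} (hP : Route C a P X) : X ∈ P := by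
  cases hP <;> simp

theorem Route.sink_mem {P : Finset ι} {X : ι} (hP : Route C a P X) : a ∈ P := by
  classical
  induction hP with
  | sink => exact Finset.mem_singleton_self a
  | step _ _ _ ih => exact Finset.mem_insert_of_mem ih

theorem Route.tail {P : Finset ι} {X Y : ι} (hP : Route C a P X) (hY : Y ∈ P) :
    ∃ P' ⊆ P, Route C a P' Y ∧ (Y ≠ X → X ∉ P') := by
  classical
  induction hP with
  | sink =>
    obtain rfl : Y = a := Finset.mem_singleton.1 hY
    exact ⟨_, subset_rfl, .sink, fun h => absurd rfl h⟩
  | step hx hP hf ih =>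
    rcases Finset.mem_insert.1 hY with rfl | hY
    · exact ⟨_, subset_rfl, .step hx hP hf, fun h => absurd rfl h⟩
    · obtain ⟨P', hPP', hP', -⟩ := ih hY
      exact ⟨P', hPP'.trans (Finset.subset_insert _ _), hP', fun _ h => hx (hPP' h)⟩

theorem Route.prepend {P : Finset ι} {Y : ι} (hP : Route C a P Y) {x : U} (hf : IsFree C x Y) :
    ∃ P', Route C a P' (C x) ∧ ∀ Z ∈ P', Z = C x ∨ Z ∈ P := by
  classical
  by_cases hx : C x ∈ P
  · obtain ⟨P', hPP', hP', -⟩ := hP.tail hx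
    exact ⟨P', hP', fun Z hZ => .inr (hPP' hZ)⟩
  · exact ⟨_, .step hx hP hf, fun Z => Finset.mem_insert.1⟩

theorem Route.congr {P : Finset ι} {X : ι} (hP : Route C a P X)
    (hkeep : ∀ v, C v ∈ P → C' v = C v) (hnew : ∀ v, C' v ∈ P → C' v ≠ X → C v = C' v) :
    Route C' a P X := by
  classical
  induction hP with
  | sink => exact .sink
  | @step P x Y hx hP hf ih =>
    have hx' : C' x = C x := hkeep x (Finset.mem_insert_self _ _)
    have hold (v : U) (hv : C' v ∈ P) : C v = C' v :=
      hnew v (Finset.mem_insert_of_mem hv) (ne_of_mem_of_not_mem hv hx)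
    rw [← hx'] at hx ⊢
    refine .step hx (ih (fun v hv => hkeep v (Finset.mem_insert_of_mem hv))
      fun v hv _ => hold v hv) fun w hw => hf w ?_
    rw [hold w (hw ▸ hP.mem), hw]

end Route

section Accessible

variable [Fintype ι] {C : G.Coloring ι} {a X Z : ι}

open Classical in
/-- The colours from which a vertex can be shifted to the class of `a` along a route. -/
noncomputable def accessible (C : G.Coloring ι) (a : ι) : Finset ι := {X | ∃ P, Route C a P X}

theorem mem_accessible : X ∈ accessible C a ↔ ∃ P, Route C a P X := by
  simp [accessible]

theorem sink_mem_accessible : a ∈ accessible C a :=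
  mem_accessible.2 ⟨_, .sink⟩

theorem Route.subset_accessible {P : Finset ι} (hP : Route C a P X) : P ⊆ accessible C a :=
  fun _ hY => let ⟨P', _, hP', _⟩ := hP.tail hY; mem_accessible.2 ⟨P', hP'⟩

theorem not_isFree_of_notMem_accessible {y : U} (hy : C y ∉ accessible C a)
    (hX : X ∈ accessible C a) : ¬ IsFree C y X := fun hf =>
  let ⟨_, hP⟩ := mem_accessible.1 hX
  let ⟨P', hP', _⟩ := hP.prepend hf
  hy (mem_accessible.2 ⟨P', hP'⟩)

open Classical in
/-- The accessible colours other than `Z` all of whose routes pass through `Z`. -/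
noncomputable def dominated (C : G.Coloring ι) (a Z : ι) : Finset ι :=
  {X ∈ accessible C a | X ≠ Z ∧ ∀ P, Route C a P X → Z ∈ P}

theorem mem_dominated : X ∈ dominated C a Z ↔
    X ∈ accessible C a ∧ X ≠ Z ∧ ∀ P, Route C a P X → Z ∈ P := by
  simp [dominated]

theorem dominated_subset_accessible : dominated C a Z ⊆ accessible C a :=
  fun _ h => (mem_dominated.1 h).1

theorem sink_notMem_dominated : a ∉ dominated C a Z := fun h =>
  let ⟨_, hne, hroute⟩ := mem_dominated.1 h
  hne (Finset.mem_singleton.1 (hroute _ .sink)).symm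

theorem dominated_ssubset (hX : X ∈ dominated C a Z) : dominated C a X ⊂ dominated C a Z := by
  obtain ⟨hXA, hXZ, hroute⟩ := mem_dominated.1 hX
  refine ⟨fun Y hY => ?_, fun h => (mem_dominated.1 (h hX)).2.1 rfl⟩
  obtain ⟨hYA, -, hYroute⟩ := mem_dominated.1 hY
  refine mem_dominated.2 ⟨hYA, ?_, fun P hP => ?_⟩
  · rintro rfl
    obtain ⟨P, hP⟩ := mem_accessible.1 hXA
    obtain ⟨P', -, hP', hXP'⟩ := hP.tail (hroute P hP)
    exact hXP' hXZ.symm (hYroute P' hP')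
  · obtain ⟨P', hPP', hP', -⟩ := hP.tail (hYroute P hP)
    exact hPP' (hroute P' hP')

theorem not_isFree_of_mem_dominated {z : U} (hz : C z ∈ dominated C a Z)
    (hX : X ∈ accessible C a) (hXd : X ∉ dominated C a Z) (hXZ : X ≠ Z) : ¬ IsFree C z X := by
  intro hf
  obtain ⟨-, hzZ, hroute⟩ := mem_dominated.1 hz
  obtain ⟨P, hP, hZP⟩ : ∃ P, Route C a P X ∧ Z ∉ P := by
    by_contra! h
    exact hXd (mem_dominated.2 ⟨hX, hXZ, h⟩)
  obtain ⟨P', hP', hmem⟩ := hP.prepend hf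
  exact (hmem Z (hroute P' hP')).elim (hzZ ·.symm) hZP

/-- `W` is terminal: the other accessible colours have routes avoiding `W`. -/
def IsTerminal (C : G.Coloring ι) (a W : ι) : Prop :=
  ∀ X ∈ accessible C a, X ≠ W → ∃ P, Route C a P X ∧ W ∉ P

theorem exists_terminal_dominated (h : accessible C a ≠ {a}) :
    ∃ Z ∈ accessible C a, (dominated C a Z).Nonempty ∧ ∀ W ∈ dominated C a Z, IsTerminal C a W := by
  have ha : (dominated C a a).Nonempty := by
    obtain ⟨X, hX, hXa⟩ := (Finset.nontrivial_iff_ne_singleton sink_mem_accessible).2 h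
      |>.exists_ne a
    exact ⟨X, mem_dominated.2 ⟨hX, hXa, fun P hP => hP.sink_mem⟩⟩
  obtain ⟨Z, ⟨hZ, hne⟩, hmin⟩ := exists_minimalFor_of_wellFoundedLT
    (fun Z => Z ∈ accessible C a ∧ (dominated C a Z).Nonempty) (dominated C a)
    ⟨a, sink_mem_accessible, ha⟩
  refine ⟨Z, hZ, hne, fun W hW X hX hXW => ?_⟩
  by_contra! hX'
  have hlt := dominated_ssubset hW
  exact hlt.2 (hmin ⟨(mem_dominated.1 hW).1, X, mem_dominated.2 ⟨hX, hXW, hX'⟩⟩ hlt.1)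

end Accessible

section Equitable

variable [Fintype U]

open Classical in
/-- The colour class of `i`, as a finite set of vertices. -/
noncomputable def classOf (C : G.Coloring ι) (i : ι) : Finset U := {v | C v = i}

theorem mem_classOf {C : G.Coloring ι} {i : ι} {v : U} : v ∈ classOf C i ↔ C v = i := by
  simp [classOf]

open Classical in
/-- Every class has `s` vertices, except that `a` has one too few and `b` one too many; the two
deviations cancel when `a = b`. Both corrections are added, as the class of `a` may be empty. -/
def NearlyEquitable (C : G.Coloring ι) (s : ℕ) (a b : ι) : Prop :=
  ∀ i, #(classOf C i) + (if i = a then 1 else 0) = s + (if i = b then 1 else 0)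

theorem NearlyEquitable.card_eq {C : G.Coloring ι} {s : ℕ} {a : ι}
    (hC : NearlyEquitable C s a a) (i : ι) : #(classOf C i) = s := by
  classical
  exact Nat.add_right_cancel (hC i)

theorem NearlyEquitable.card_eq_of_ne {C : G.Coloring ι} {s : ℕ} {a b i : ι}
    (hC : NearlyEquitable C s a b) (ha : i ≠ a) (hb : i ≠ b) : #(classOf C i) = s := by
  simpa [ha, hb] using hC i

section Recolor

variable {H : SimpleGraph U} {C : H.Coloring ι} {x : U} {i : ι}
  {hG : ∀ u v, u ≠ x → v ≠ x → G.Adj u v → H.Adj u v}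
  {hi : ∀ w, w ≠ x → C w = i → ¬ G.Adj x w}

open Classical in
theorem card_classOf_recolor (j : ι) :
    #(classOf (recolor C x i hG hi) j) + (if j = C x then 1 else 0) =
      #(classOf C j) + (if j = i then 1 else 0) := by
  have key (f : U → ι) : #{v | f v = j} =
      #{v ∈ Finset.univ.erase x | f v = j} + (if j = f x then 1 else 0) := by
    rw [← Finset.insert_erase (Finset.mem_univ x), Finset.filter_insert]
    by_cases h : f x = j
    · simp [h]
    · simp [h, Ne.symm h]
  have herase : ({v ∈ Finset.univ.erase x | recolor C x i hG hi v = j} : Finset U) =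
      {v ∈ Finset.univ.erase x | C v = j} :=
    Finset.filter_congr fun v hv => by rw [recolor_of_ne (Finset.ne_of_mem_erase hv)]
  rw [classOf, classOf, key, key C, herase, recolor_self]
  exact add_right_comm ..

theorem NearlyEquitable.recolor {s : ℕ} {a : ι} (hC : NearlyEquitable C s a (C x)) :
    NearlyEquitable (recolor C x i hG hi) s a i := by
  classical
  intro j
  have := hC j
  have := card_classOf_recolor (hG := hG) (hi := hi) j
  omega

end Recolor

theorem Route.exists_equitable {C : G.Coloring ι} {a : ι} {s : ℕ} {P : Finset ι} {X : ι}
    (hP : Route C a P X) (hC : NearlyEquitable C s a X) :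
    ∃ C' : G.Coloring ι, ∀ i, #(classOf C' i) = s := by
  classical
  induction hn : #P generalizing C P X with
  | zero => exact absurd hP.mem (Finset.card_eq_zero.1 hn ▸ Finset.notMem_empty X)
  | succ n ih =>
    cases hP with
    | sink => exact ⟨C, hC.card_eq⟩
    | @step P x Y hx hP hf =>
      let C' := recolor C x Y (fun _ _ _ _ h => h) fun w _ => hf w
      have hC' (v : U) (hv : v ≠ x) : C' v = C v := recolor_of_ne hv
      have hP' : Route C' a P Y := hP.congr
        (fun v hv => hC' v fun h => hx (h ▸ hv))
        fun v _ hvY => (hC' v fun h => hvY (h ▸ recolor_self)).symm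
      refine ih hP' hC.recolor ?_
      rwa [Finset.card_insert_of_notMem hx, Nat.add_right_cancel_iff] at hn

end Equitable

section Solo

open Classical in
/-- The number of neighbours of `x` in `B`. -/
noncomputable def degreeIn (G : SimpleGraph U) (B : Finset U) (x : U) : ℕ := #{y ∈ B | G.Adj x y}

theorem degreeIn_mono {H : SimpleGraph U} (h : H ≤ G) {B : Finset U} {x : U} :
    degreeIn H B x ≤ degreeIn G B x := by
  classical
  exact Finset.card_le_card (Finset.monotone_filter_right _ fun _ _ hxy => h hxy)

theorem degreeIn_lt_card [Fintype U] {x : U} : degreeIn G Finset.univ x < Fintype.card U :=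
  Finset.card_lt_univ_of_notMem (x := x) (by simp)

section Sum

variable {V : Type*} [Fintype U] [Fintype V] {H : SimpleGraph V}

theorem degreeIn_sum_inl {x : U} :
    degreeIn (G ⊕g H) Finset.univ (.inl x) = degreeIn G Finset.univ x := by
  rw [degreeIn, degreeIn, ← Finset.card_map (.inl : U ↪ U ⊕ V)]
  congr 1
  ext (y | y) <;> simp [Finset.mem_filter]

theorem degreeIn_sum_inr {x : V} :
    degreeIn (G ⊕g H) Finset.univ (.inr x) = degreeIn H Finset.univ x := by
  rw [degreeIn, degreeIn, ← Finset.card_map (.inr : V ↪ U ⊕ V)]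
  congr 1
  ext (y | y) <;> simp [Finset.mem_filter]

end Sum

theorem sum_degreeIn_comm (B S : Finset U) :
    ∑ y ∈ B, degreeIn G S y = ∑ z ∈ S, degreeIn G B z := by
  classical
  have h := Finset.sum_card_bipartiteAbove_eq_sum_card_bipartiteBelow G.Adj (s := B) (t := S)
  simpa only [Finset.bipartiteAbove, Finset.bipartiteBelow, degreeIn, G.adj_comm] using h

open Classical in
theorem exists_isIndepSet_card_le (B : Finset U) :
    ∃ I ⊆ B, G.IsIndepSet I ∧ #B ≤ ∑ y ∈ I, (degreeIn G B y + 1) := by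
  obtain ⟨I, hImem, hmax⟩ := Finset.exists_maximalFor id
    ({I ∈ B.powerset | G.IsIndepSet I} : Finset (Finset U)) ⟨∅, by simp⟩
  obtain ⟨hIB, hI⟩ := Finset.mem_filter.1 hImem
  rw [Finset.mem_powerset] at hIB
  refine ⟨I, hIB, hI, ?_⟩
  have hcover : B ⊆ I.biUnion fun y => insert y {w ∈ B | G.Adj y w} := by
    intro w hw
    by_contra hwI
    simp only [Finset.mem_biUnion, Finset.mem_insert, Finset.mem_filter, not_exists, not_and,
      not_or] at hwI
    have hins : G.IsIndepSet ↑(insert w I) := by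
      rw [Finset.coe_insert]
      exact hI.insert fun y hy _ => ⟨fun h => (hwI y hy).2 hw h.symm, (hwI y hy).2 hw⟩
    have hsub := hmax (Finset.mem_filter.2 ⟨Finset.mem_powerset.2
      (Finset.insert_subset hw hIB), hins⟩) (Finset.subset_insert w I)
    exact (hwI w (hsub (Finset.mem_insert_self w I))).1 rfl
  exact (Finset.card_le_card hcover).trans <| Finset.card_biUnion_le.trans <|
    Finset.sum_le_sum fun y _ => Finset.card_insert_le _ _

variable [Fintype U] {C : G.Coloring ι} {a b Z : ι} {s : ℕ}

theorem degreeIn_classOf_pos {x : U} {i : ι} (h : ¬ IsFree C x i) :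
    1 ≤ degreeIn G (classOf C i) x := by
  simp only [IsFree, not_forall, not_not] at h
  obtain ⟨w, hw, hxw⟩ := h
  exact Finset.card_pos.2 ⟨w, by simp [mem_classOf, hw, hxw]⟩

open Classical in
theorem sum_card_classOf_filter (T : Finset ι) (p : U → Prop) :
    ∑ i ∈ T, #{z ∈ classOf C i | p z} = #{z | C z ∈ T ∧ p z} := by
  rw [Finset.card_eq_sum_card_fiberwise (f := fun z => C z) (t := T) fun w hw =>
    (Finset.mem_filter.1 hw).2.1]
  refine Finset.sum_congr rfl fun i hi => ?_
  congr 1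
  ext z
  simp only [Finset.mem_filter, mem_classOf, Finset.mem_univ, true_and]
  exact ⟨fun ⟨hz, h⟩ => ⟨⟨hz ▸ hi, h⟩, hz⟩, fun ⟨⟨_, h⟩, hz⟩ => ⟨hz, h⟩⟩

theorem sum_degreeIn_classOf_add_le (x : U) {T : Finset ι} {B : Finset U}
    (hB : ∀ y ∈ B, C y ∉ T) :
    ∑ i ∈ T, degreeIn G (classOf C i) x + degreeIn G B x ≤ degreeIn G Finset.univ x := by
  classical
  simp only [degreeIn]
  rw [sum_card_classOf_filter, ← Finset.card_union_of_disjoint]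
  · refine Finset.card_le_card fun w hw => ?_
    simp only [Finset.mem_union, Finset.mem_filter, Finset.mem_univ, true_and] at hw ⊢
    exact hw.elim And.right And.right
  · refine Finset.disjoint_left.2 fun w hw hw' => ?_
    exact hB w (Finset.mem_filter.1 hw').1 (Finset.mem_filter.1 hw).2.1

/-- `z` is the only neighbour of `y` in the class of `z`, so that `y` can take the place of `z`. -/
def Solo (C : G.Coloring ι) (y z : U) : Prop :=
  G.Adj y z ∧ ∀ w, C w = C z → G.Adj y w → w = z

open Classical in
theorem two_le_degreeIn_add_card_solo {y : U} {i : ι} (h : ¬ IsFree C y i) :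
    2 ≤ degreeIn G (classOf C i) y + #{z ∈ classOf C i | Solo C y z} := by
  rcases (degreeIn_classOf_pos h).eq_or_lt with h1 | h2
  · obtain ⟨z, hz⟩ := Finset.card_eq_one.1 h1.symm
    have hzmem (w : U) : C w = i ∧ G.Adj y w ↔ w = z := by
      simpa only [Finset.mem_filter, mem_classOf, Finset.mem_singleton] using Finset.ext_iff.1 hz w
    obtain ⟨hzi, hyz⟩ := (hzmem z).2 rfl
    have : 0 < #{z ∈ classOf C i | Solo C y z} := Finset.card_pos.2 ⟨z, Finset.mem_filter.2
      ⟨mem_classOf.2 hzi, hyz, fun w hw hyw => (hzmem w).1 ⟨hw.trans hzi, hyw⟩⟩⟩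
    omega
  · exact le_add_right h2

variable [Fintype ι]

open Classical in
/-- The vertices whose colour is not accessible. -/
noncomputable def outer (C : G.Coloring ι) (a : ι) : Finset U := {y | C y ∉ accessible C a}

theorem mem_outer {y : U} : y ∈ outer C a ↔ C y ∉ accessible C a := by
  simp [outer]

open Classical in
theorem NearlyEquitable.card_outer (hC : NearlyEquitable C s a b) (hb : b ∉ accessible C a) :
    #(outer C a) = #(accessible C a)ᶜ * s + 1 := by
  have hsize (i : ι) (hi : i ∈ (accessible C a)ᶜ) :
      #{y ∈ outer C a | C y = i} = s + if i = b then 1 else 0 := by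
    have hia : i ≠ a := fun h => Finset.mem_compl.1 hi (h ▸ sink_mem_accessible)
    have : ({y ∈ outer C a | C y = i} : Finset U) = classOf C i := by
      ext y
      simp only [Finset.mem_filter, mem_outer, mem_classOf, and_iff_right_iff_imp]
      exact fun hy => hy ▸ Finset.mem_compl.1 hi
    rw [this, ← hC i, if_neg hia, add_zero]
  rw [Finset.card_eq_sum_card_fiberwise (f := C) (t := (accessible C a)ᶜ)
    fun y hy => Finset.mem_coe.2 (Finset.mem_compl.2 (mem_outer.1 hy)), Finset.sum_congr rfl hsize,
    Finset.sum_add_distrib, Finset.sum_const, smul_eq_mul, Finset.sum_ite_eq',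
    if_pos (Finset.mem_compl.2 hb)]

theorem degreeIn_outer_add_card_lt (hdeg : ∀ x, degreeIn G Finset.univ x < Fintype.card ι) {x : U}
    {T : Finset ι} (hT : T ⊆ accessible C a) (hx : ∀ X ∈ T, ¬ IsFree C x X) :
    degreeIn G (outer C a) x + #T < Fintype.card ι := by
  have hsum : #T ≤ ∑ i ∈ T, degreeIn G (classOf C i) x := by
    simpa using Finset.card_nsmul_le_sum T _ 1 fun i hi => degreeIn_classOf_pos (hx i hi)
  have := sum_degreeIn_classOf_add_le x (B := outer C a) fun y hy hyT => mem_outer.1 hy (hT hyT)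
  have := hdeg x
  omega

theorem NearlyEquitable.accessible_ne_singleton
    (hdeg : ∀ x, degreeIn G Finset.univ x < Fintype.card ι) (hC : NearlyEquitable C s a b)
    (hb : b ∉ accessible C a) : accessible C a ≠ {a} := by
  classical
  intro hA
  have hab : a ≠ b := fun h => hb (h ▸ sink_mem_accessible)
  have hlow : #(outer C a) ≤ ∑ y ∈ outer C a, degreeIn G (classOf C a) y := by
    simpa using Finset.card_nsmul_le_sum (outer C a) _ 1 fun y hy =>
      degreeIn_classOf_pos (not_isFree_of_notMem_accessible (mem_outer.1 hy) sink_mem_accessible)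
  have hup : ∑ z ∈ classOf C a, degreeIn G (outer C a) z ≤
      #(classOf C a) * #(accessible C a)ᶜ := by
    refine Finset.sum_le_card_nsmul _ _ _ fun z _ => ?_
    have := degreeIn_outer_add_card_lt (C := C) (a := a) hdeg (x := z) (T := ∅) (by simp) (by simp)
    have := Finset.card_compl_add_card (accessible C a)
    rw [hA, Finset.card_singleton] at this
    rw [hA]
    omega
  have hsize : #(classOf C a) + 1 = s := by simpa [hab] using hC a
  rw [sum_degreeIn_comm, hC.card_outer hb] at hlow
  have := hlow.trans hup
  rw [← hsize] at this
  nlinarith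

open Classical in
theorem card_accessible_add_card_lt_add_card_solo
    (hdeg : ∀ x, degreeIn G Finset.univ x < Fintype.card ι) {y : U} (hy : y ∈ outer C a)
    {T : Finset ι} (hT : T ⊆ accessible C a) :
    #(accessible C a) + #T + degreeIn G (outer C a) y <
      Fintype.card ι + #{z | C z ∈ T ∧ Solo C y z} := by
  have hfree (i : ι) (hi : i ∈ accessible C a) : ¬ IsFree C y i :=
    not_isFree_of_notMem_accessible (mem_outer.1 hy) hi
  have hin := Finset.card_nsmul_le_sum T _ 2 fun i hi =>
    two_le_degreeIn_add_card_solo (hfree i (hT hi))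
  rw [Finset.sum_add_distrib, sum_card_classOf_filter, smul_eq_mul] at hin
  have hout := Finset.card_nsmul_le_sum (accessible C a \ T) _ 1 fun i hi =>
    degreeIn_classOf_pos (hfree i (Finset.mem_sdiff.1 hi).1)
  have hsum := Finset.sum_sdiff hT (f := fun i => degreeIn G (classOf C i) y)
  have hdegree :=
    sum_degreeIn_classOf_add_le y (C := C) (T := accessible C a) fun y hy => mem_outer.1 hy
  have := Finset.card_sdiff_add_card_eq_card hT
  have := hdeg y
  simp only [smul_eq_mul, mul_one] at hout
  omega

/-- No vertex `z` in a class of `T` that could be replaced by an outer vertex can move to another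
accessible class. -/
def NoMovableSolo (C : G.Coloring ι) (a : ι) (T : Finset ι) : Prop :=
  ∀ y ∈ outer C a, ∀ z, C z ∈ T → Solo C y z → ∀ X ∈ accessible C a, X ≠ C z → ¬ IsFree C z X

open Classical in
theorem NoMovableSolo.degreeIn_add_card_solo_le
    (hdeg : ∀ x, degreeIn G Finset.univ x < Fintype.card ι) (hZ : Z ∈ accessible C a)
    (hno : NoMovableSolo C a (dominated C a Z)) (hle : #(dominated C a Z) ≤ #(accessible C a)ᶜ)
    {z : U} (hz : C z ∈ dominated C a Z) :
    degreeIn G (outer C a) z + #{y ∈ outer C a | Solo C y z} ≤ 2 * #(accessible C a)ᶜ := by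
  have hcard := Finset.card_compl_add_card (accessible C a)
  have hsub := dominated_subset_accessible (C := C) (a := a) (Z := Z)
  rcases Finset.eq_empty_or_nonempty {y ∈ outer C a | Solo C y z} with hS | ⟨y, hy⟩
  · have hZd : Z ∉ dominated C a Z := fun h => (mem_dominated.1 h).2.1 rfl
    have h := degreeIn_outer_add_card_lt hdeg (x := z) (a := a)
      (T := (accessible C a \ dominated C a Z).erase Z)
      ((Finset.erase_subset _ _).trans Finset.sdiff_subset) fun X hX =>
        have hX' := Finset.mem_sdiff.1 (Finset.mem_of_mem_erase hX)
        not_isFree_of_mem_dominated hz hX'.1 hX'.2 (Finset.ne_of_mem_erase hX)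
    have := Finset.card_erase_add_one (Finset.mem_sdiff.2 ⟨hZ, hZd⟩)
    have := Finset.card_sdiff_add_card_eq_card hsub
    rw [hS, Finset.card_empty]
    omega
  · obtain ⟨hyB, hyz⟩ := Finset.mem_filter.1 hy
    have h := degreeIn_outer_add_card_lt hdeg (x := z) (a := a)
      (Finset.erase_subset (C z) (accessible C a)) fun X hX =>
        hno y hyB z hz hyz X (Finset.mem_of_mem_erase hX) (Finset.ne_of_mem_erase hX)
    have := Finset.card_erase_add_one (hsub hz)
    have : #{y ∈ outer C a | Solo C y z} ≤ degreeIn G (outer C a) z :=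
      Finset.card_le_card (Finset.monotone_filter_right _ fun y _ h => h.1.symm)
    omega

theorem NoMovableSolo.card_compl_lt (hdeg : ∀ x, degreeIn G Finset.univ x < Fintype.card ι)
    (hC : NearlyEquitable C s a b) (hb : b ∉ accessible C a) (hZ : Z ∈ accessible C a)
    (hne : (dominated C a Z).Nonempty) (hno : NoMovableSolo C a (dominated C a Z)) :
    Fintype.card ι < #(accessible C a) + #(dominated C a Z) := by
  classical
  have hcard := Finset.card_compl_add_card (accessible C a)
  by_contra! hle
  obtain ⟨W, hW⟩ := hne
  have hWA := (mem_dominated.1 hW).1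
  have hlow := Finset.card_nsmul_le_sum (outer C a) _ 2 fun y hy =>
    two_le_degreeIn_add_card_solo (not_isFree_of_notMem_accessible (mem_outer.1 hy) hWA)
  have hup := Finset.sum_le_card_nsmul (classOf C W) _ _ fun z hz =>
    hno.degreeIn_add_card_solo_le hdeg hZ (by omega) (mem_classOf.1 hz ▸ hW)
  have hcomm := Finset.sum_card_bipartiteAbove_eq_sum_card_bipartiteBelow (Solo C)
    (s := outer C a) (t := classOf C W)
  have hsize : #(classOf C W) = s := hC.card_eq_of_ne
    (fun h => sink_notMem_dominated (h ▸ hW)) fun h => hb (h ▸ hWA)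
  simp only [Finset.bipartiteAbove, Finset.bipartiteBelow] at hcomm
  rw [Finset.sum_add_distrib, sum_degreeIn_comm, hcomm, ← Finset.sum_add_distrib,
    hC.card_outer hb] at hlow
  have := hlow.trans hup
  rw [hsize, smul_eq_mul, smul_eq_mul] at this
  nlinarith

open Classical in
theorem NearlyEquitable.exists_isIndepSet_card_lt_sum_solo
    (hdeg : ∀ x, degreeIn G Finset.univ x < Fintype.card ι) (hC : NearlyEquitable C s a b)
    (hb : b ∉ accessible C a) {T : Finset ι} (hT : T ⊆ accessible C a) (ha : a ∉ T)
    (hlt : Fintype.card ι < #(accessible C a) + #T) :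
    ∃ I ⊆ outer C a, G.IsIndepSet I ∧
      #{z | C z ∈ T} < ∑ y ∈ I, #{z ∈ {z | C z ∈ T} | Solo C y z} := by
  have hcard := Finset.card_compl_add_card (accessible C a)
  obtain ⟨I, hIB, hI, hIcard⟩ := exists_isIndepSet_card_le (G := G) (outer C a)
  refine ⟨I, hIB, hI, ?_⟩
  set q := #(accessible C a)ᶜ
  have hIs : s + 1 ≤ #I := by
    have := hIcard.trans <| Finset.sum_le_card_nsmul I _ q fun y hy => by
      have := degreeIn_outer_add_card_lt hdeg (x := y) subset_rfl fun X hX =>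
        not_isFree_of_notMem_accessible (mem_outer.1 (hIB hy)) hX
      omega
    rw [hC.card_outer hb, smul_eq_mul] at this
    by_contra! hIs
    nlinarith
  have hcardT : #{z | C z ∈ T} = #T * s := by
    have := sum_card_classOf_filter (C := C) T fun _ => True
    simp only [Finset.filter_true, and_true] at this
    rw [← this]
    exact Finset.sum_const_nat fun W hW => hC.card_eq_of_ne
      (fun h => ha (h ▸ hW)) fun h => hb (h ▸ hT hW)
  have hsum := Finset.sum_le_sum fun y hy =>
    Nat.succ_le_of_lt (card_accessible_add_card_lt_add_card_solo hdeg (hIB hy) hT)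
  simp only [Nat.succ_eq_add_one, add_assoc, Finset.sum_add_distrib, Finset.sum_const,
    smul_eq_mul, ← hcard] at hsum hIcard
  rw [hC.card_outer hb] at hIcard
  simp only [Finset.filter_filter, hcardT]
  obtain ⟨r, hr⟩ := Nat.exists_eq_add_of_le (show q + 1 ≤ #T by omega)
  have hIr : (s + 1) * r ≤ #I * r := Nat.mul_le_mul_right r hIs
  change _ * _ + (#I * #T + _) ≤ _ at hsum
  rw [hr] at hsum ⊢
  nlinarith

theorem NoMovableSolo.exists_solo_pair (hdeg : ∀ x, degreeIn G Finset.univ x < Fintype.card ι)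
    (hC : NearlyEquitable C s a b) (hb : b ∉ accessible C a) (hZ : Z ∈ accessible C a)
    (hne : (dominated C a Z).Nonempty) (hno : NoMovableSolo C a (dominated C a Z)) :
    ∃ z y y', C z ∈ dominated C a Z ∧ y ∈ outer C a ∧ y' ∈ outer C a ∧ y ≠ y' ∧ ¬ G.Adj y y' ∧
      Solo C y z ∧ Solo C y' z := by
  classical
  obtain ⟨I, hIB, hI, hsolo⟩ := hC.exists_isIndepSet_card_lt_sum_solo hdeg hb
    dominated_subset_accessible sink_notMem_dominated (hno.card_compl_lt hdeg hC hb hZ hne)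
  have hcomm := Finset.sum_card_bipartiteAbove_eq_sum_card_bipartiteBelow (Solo C)
    (s := I) (t := {z | C z ∈ dominated C a Z})
  simp only [Finset.bipartiteAbove, Finset.bipartiteBelow] at hcomm
  rw [hcomm, Finset.card_eq_sum_ones] at hsolo
  obtain ⟨z, hz, hlt⟩ := Finset.exists_lt_of_sum_lt hsolo
  obtain ⟨y, hy, y', hy', hne⟩ := Finset.one_lt_card.1 hlt
  rw [Finset.mem_filter] at hy hy'
  exact ⟨z, y, y', (Finset.mem_filter.1 hz).2, hIB hy.1, hIB hy'.1, hne,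
    hI hy.1 hy'.1 hne, hy.2, hy'.2⟩

end Solo

section Swap

variable [Fintype U] [Fintype ι] {C : G.Coloring ι} {a b X : ι} {s : ℕ} {y y' z : U}

/-- `C'` arises from `C` by moving the outer vertex `y` to the class of `z` and redistributing the
remaining outer vertices among the inaccessible colours. It is a colouring only off `z`, which is
meant to be recoloured next. -/
structure IsSwap (C : G.Coloring ι) (a : ι) (y z : U) (C' : (G.deleteIncidenceSet z).Coloring ι) :
    Prop where
  moved : C' y = C z
  keep : ∀ v, C v ∈ accessible C a → C' v = C v
  stay : ∀ v ∈ outer C a, v ≠ y → C' v ∉ accessible C a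

section SwapColor

variable [DecidableEq U]
  {D : (G.induce ((outer C a).erase y : Set U)).Coloring {i // i ∉ accessible C a}}

/-- The colouring that gives `y` the colour of `z` and the remaining outer vertices their colours
under `D`. -/
noncomputable def swapColor (C : G.Coloring ι) (a : ι) (y z : U)
    (D : (G.induce ((outer C a).erase y : Set U)).Coloring {i // i ∉ accessible C a}) : U → ι :=
  fun v => if v = y then C z else if h : v ∈ (outer C a).erase y then D ⟨v, h⟩ else C v

theorem swapColor_self : swapColor C a y z D y = C z := if_pos rfl

theorem swapColor_of_mem_erase {v : U} (hv : v ∈ (outer C a).erase y) :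
    swapColor C a y z D v = D ⟨v, hv⟩ := by
  simp only [swapColor, if_neg (Finset.ne_of_mem_erase hv), dif_pos hv]

theorem swapColor_notMem_accessible {v : U} (hv : v ∈ (outer C a).erase y) :
    swapColor C a y z D v ∉ accessible C a :=
  swapColor_of_mem_erase hv ▸ (D ⟨v, hv⟩).2

theorem swapColor_of_mem_accessible (hy : y ∈ outer C a) {v : U} (hv : C v ∈ accessible C a) :
    swapColor C a y z D v = C v := by
  have hvB : v ∉ outer C a := fun h => mem_outer.1 h hv
  simp only [swapColor, if_neg (ne_of_mem_of_not_mem hy hvB).symm, Finset.mem_erase, hvB,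
    and_false, dite_false]

theorem eq_or_mem_erase_outer_or_mem_accessible (C : G.Coloring ι) (a : ι) (y v : U) :
    v = y ∨ v ∈ (outer C a).erase y ∨ C v ∈ accessible C a := by
  rw [Finset.mem_erase, mem_outer]
  tauto

theorem swapColor_ne (hy : y ∈ outer C a) (hz : C z ∈ accessible C a) (hyz : Solo C y z) {u v : U}
    (huv : (G.deleteIncidenceSet z).Adj u v) : swapColor C a y z D u ≠ swapColor C a y z D v := by
  have hsolo (v : U) (hvz : v ≠ z) (hv : C v ∈ accessible C a) (hyv : G.Adj y v) :
      swapColor C a y z D v ≠ C z :=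
    fun he => hvz (hyz.2 v (swapColor_of_mem_accessible hy hv ▸ he) hyv)
  have hcross {u v : U} (hu : u ∈ (outer C a).erase y)
      (hv : swapColor C a y z D v ∈ accessible C a) :
      swapColor C a y z D u ≠ swapColor C a y z D v :=
    fun he => swapColor_notMem_accessible hu (he ▸ hv)
  have hself : swapColor C a y z D y = C z := swapColor_self
  have hinner {v : U} (hv : C v ∈ accessible C a) : swapColor C a y z D v ∈ accessible C a :=
    (swapColor_of_mem_accessible hy hv).symm ▸ hv
  obtain ⟨hadj, huz, hvz⟩ := SimpleGraph.deleteIncidenceSet_adj.1 huv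
  have hmem := eq_or_mem_erase_outer_or_mem_accessible C a y
  rcases hmem u with rfl | hu | hu <;> rcases hmem v with rfl | hv | hv
  · exact absurd hadj (G.loopless.irrefl _)
  · exact (hcross hv (hself ▸ hz)).symm
  · exact hself ▸ (hsolo v hvz hv hadj).symm
  · exact hcross hu (hself ▸ hz)
  · rw [swapColor_of_mem_erase hu, swapColor_of_mem_erase hv]
    exact fun he => D.valid (v := ⟨u, hu⟩) (w := ⟨v, hv⟩) hadj (Subtype.ext he)
  · exact hcross hu (hinner hv)
  · exact hself ▸ hsolo u huz hu hadj.symm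
  · exact (hcross hv (hinner hu)).symm
  · rw [swapColor_of_mem_accessible hy hu, swapColor_of_mem_accessible hy hv]
    exact C.valid hadj

theorem swapColor_eq_iff (hy : y ∈ outer C a) (hz : C z ∈ accessible C a) {i : ι}
    (hi : i ∉ accessible C a) (v : U) :
    swapColor C a y z D v = i ↔ ∃ hv : v ∈ (outer C a).erase y, D ⟨v, hv⟩ = ⟨i, hi⟩ := by
  rcases eq_or_mem_erase_outer_or_mem_accessible C a y v with rfl | hv | hv
  · exact ⟨fun h => absurd (swapColor_self.symm.trans h ▸ hz) hi,
      fun ⟨h, _⟩ => absurd rfl (Finset.ne_of_mem_erase h)⟩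
  · rw [swapColor_of_mem_erase hv]
    exact ⟨fun h => ⟨hv, Subtype.ext h⟩, fun ⟨_, h⟩ => congrArg _ h⟩
  · exact ⟨fun h => absurd (h ▸ swapColor_of_mem_accessible hy hv ▸ hv) hi, fun ⟨h, _⟩ =>
      absurd hv (mem_outer.1 (Finset.mem_of_mem_erase h))⟩

end SwapColor

open Classical in
theorem exists_isSwap (hy : y ∈ outer C a) (hz : C z ∈ accessible C a) (hyz : Solo C y z)
    (D : (G.induce ((outer C a).erase y : Set U)).Coloring {i // i ∉ accessible C a})
    (hD : ∀ i, #(classOf D i) = s) :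
    ∃ C' : (G.deleteIncidenceSet z).Coloring ι, IsSwap C a y z C' ∧
      ∀ i ∉ accessible C a, #(classOf C' i) = s := by
  refine ⟨SimpleGraph.Coloring.mk (swapColor C a y z D) (swapColor_ne hy hz hyz),
    ⟨swapColor_self, fun v => swapColor_of_mem_accessible hy, fun v hv hvy =>
      swapColor_notMem_accessible (Finset.mem_erase.2 ⟨hvy, hv⟩)⟩, fun i hi => ?_⟩
  rw [← hD ⟨i, hi⟩, ← Finset.card_map (Function.Embedding.subtype _)]
  congr 1
  ext v
  simp only [mem_classOf, Finset.mem_map, Function.Embedding.subtype_apply, Subtype.exists,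
    exists_and_right, exists_eq_right]
  exact swapColor_eq_iff hy hz hi v

theorem IsSwap.nearlyEquitable {C' : (G.deleteIncidenceSet z).Coloring ι} (h : IsSwap C a y z C')
    (hC : NearlyEquitable C s a b) (hb : b ∉ accessible C a) (hy : y ∈ outer C a)
    (hz : C z ∈ accessible C a) (hout : ∀ i ∉ accessible C a, #(classOf C' i) = s) :
    NearlyEquitable C' s a (C z) := by
  classical
  intro i
  by_cases hi : i ∈ accessible C a
  · have hmem (v : U) : C' v = i ↔ C v = i ∨ v = y ∧ i = C z := by
      by_cases hv : C v ∈ accessible C a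
      · rw [h.keep v hv, iff_self_or]
        exact fun ⟨hvy, _⟩ => absurd hv (hvy ▸ mem_outer.1 hy)
      · have hvi : C v ≠ i := fun hvi => hv (hvi ▸ hi)
        by_cases hvy : v = y
        · subst hvy
          rw [h.moved]
          exact ⟨fun h => .inr ⟨rfl, h.symm⟩, fun h => h.elim (absurd · hvi) (·.2.symm)⟩
        · have : C' v ≠ i := fun hvi => h.stay v (mem_outer.2 hv) hvy (hvi ▸ hi)
          simp only [hvi, hvy, this, false_and, or_self]
    have hyC : y ∉ classOf C i := fun hyi => mem_outer.1 hy (mem_classOf.1 hyi ▸ hi)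
    have hcard : #(classOf C' i) = #(classOf C i) + if i = C z then 1 else 0 := by
      split_ifs with hiz
      · rw [← Finset.card_insert_of_notMem hyC]
        congr 1
        ext v
        rw [mem_classOf, hmem, Finset.mem_insert, mem_classOf, or_comm, and_iff_left hiz]
      · congr 1
        ext v
        simp only [mem_classOf, hmem, hiz, and_false, or_false]
    have := hC i
    rw [if_neg (ne_of_mem_of_not_mem hi hb)] at this
    omega
  · have hia : i ≠ a := fun h => hi (h ▸ sink_mem_accessible)
    have hiz : i ≠ C z := fun h => hi (h ▸ hz)
    rw [hout i hi, if_neg hia, if_neg hiz]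

variable {C' : (G.deleteIncidenceSet z).Coloring ι}

theorem IsSwap.exists_free (h : IsSwap C a y z C')
    (hdeg : ∀ x, degreeIn G Finset.univ x < Fintype.card ι) (hy : y ∈ outer C a)
    (hz : C z ∈ accessible C a) (hyz : G.Adj y z)
    (hno : ∀ X ∈ accessible C a, X ≠ C z → ¬ IsFree C z X) :
    ∃ X ∉ accessible C a, ∀ w, w ≠ z → C' w = X → ¬ G.Adj z w := by
  classical
  by_contra! hcon
  have hdz := degreeIn_outer_add_card_lt hdeg (x := z) (a := a)
    (Finset.erase_subset (C z) (accessible C a)) fun X hX =>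
      hno X (Finset.mem_of_mem_erase hX) (Finset.ne_of_mem_erase hX)
  have hle : #(accessible C a)ᶜ ≤ #({w ∈ outer C a | G.Adj z w}.erase y) := by
    refine Finset.card_le_card_of_surjOn (fun w => C' w) fun X hX => ?_
    have hXA := Finset.mem_compl.1 hX
    obtain ⟨w, -, hw, hzw⟩ := hcon X hXA
    refine ⟨w, Finset.mem_coe.2 (Finset.mem_erase.2 ⟨?_, Finset.mem_filter.2 ⟨?_, hzw⟩⟩), hw⟩
    · rintro rfl
      exact hXA (hw ▸ h.moved ▸ hz)
    · exact mem_outer.2 fun hwA => hXA (hw ▸ (h.keep w hwA).symm ▸ hwA)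
  have := Finset.card_erase_add_one (s := {w ∈ outer C a | G.Adj z w})
    (Finset.mem_filter.2 ⟨hy, hyz.symm⟩)
  have := Finset.card_erase_add_one hz
  have := Finset.card_compl_add_card (accessible C a)
  have hdz' : degreeIn G (outer C a) z = #{w ∈ outer C a | G.Adj z w} := rfl
  omega

variable {hG : ∀ u v, u ≠ z → v ≠ z → G.Adj u v → (G.deleteIncidenceSet z).Adj u v}
  {hX : ∀ w, w ≠ z → C' w = X → ¬ G.Adj z w}

theorem IsSwap.route (h : IsSwap C a y z C')
    {P : Finset ι} {Y : ι} (hP : Route C a P Y) (hzP : C z ∉ P)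
    (hYX : X ∈ accessible C a → Y = X) :
    Route (recolor C' z X hG hX) a P Y := by
  have hPA := hP.subset_accessible
  refine hP.congr (fun v hv => ?_) fun v hv hvY => ?_
  · have hvz : v ≠ z := by
      rintro rfl
      exact hzP hv
    rw [recolor_of_ne hvz, h.keep v (hPA hv)]
  · by_cases hvz : v = z
    · rw [hvz, recolor_self] at hv hvY
      exact absurd (hYX (hPA hv)).symm hvY
    rw [recolor_of_ne hvz] at hv ⊢
    by_contra hne
    have hvB : v ∈ outer C a := mem_outer.2 fun hvA => hne (h.keep v hvA).symm
    by_cases hvy : v = y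
    · exact hzP (h.moved ▸ hvy ▸ hv)
    · exact h.stay v hvB hvy (hPA hv)

theorem IsSwap.recolor_of_mem (h : IsSwap C a y z C') {w : U} (hwz : w ≠ z)
    (hw : C w ∈ accessible C a) : recolor C' z X hG hX w = C w :=
  (recolor_of_ne hwz).trans (h.keep w hw)

theorem IsSwap.eq_or_of_recolor_mem (h : IsSwap C a y z C') (hXA : X ∉ accessible C a) {w : U}
    (hw : recolor C' z X hG hX w ∈ accessible C a) :
    w ≠ z ∧ (recolor C' z X hG hX w = C w ∨ w = y) := by
  have hwz : w ≠ z := by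
    rintro rfl
    rw [recolor_self] at hw
    exact hXA hw
  rw [recolor_of_ne hwz] at hw ⊢
  refine ⟨hwz, ?_⟩
  by_contra! hw'
  exact h.stay w (mem_outer.2 fun hwA => hw'.1 (h.keep w hwA)) hw'.2 hw

theorem IsSwap.mem_accessible (h : IsSwap C a y z C') (hzA : C z ∈ accessible C a)
    (hza : C z ≠ a) (hterm : IsTerminal C a (C z))
    (hno : ∀ Y ∈ accessible C a, Y ≠ C z → ¬ IsFree C z Y) (hXA : X ∉ accessible C a) :
    C z ∈ accessible (recolor C' z X hG hX) a := by
  obtain ⟨P, hP⟩ := DiEmbed.mem_accessible.1 hzA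
  generalize hW : C z = W at hP
  cases hP with
  | sink => exact absurd hW hza
  | @step P x Y hx hP hf =>
    have hY := hP.subset_accessible hP.mem
    have hYz : Y ≠ C z := by
      rintro rfl
      exact hx (hW ▸ hP.mem)
    have hxz : x ≠ z := by
      rintro rfl
      exact hno Y hY hYz hf
    obtain ⟨P', hP', hzP'⟩ := hterm Y hY hYz
    have hP₁ : Route (recolor C' z X hG hX) a P' Y :=
      h.route hP' hzP' fun hX => absurd hX hXA
    rw [← h.recolor_of_mem (hG := hG) (hX := hX) hxz (hW ▸ hzA)]
    obtain ⟨P₂, hP₂, -⟩ := hP₁.prepend (x := x) fun w hw => by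
      obtain ⟨hwz, hwC | rfl⟩ := h.eq_or_of_recolor_mem hXA (hw ▸ hY)
      · exact hf w (hwC ▸ hw)
      · rw [recolor_of_ne hwz, h.moved] at hw
        exact absurd hw.symm hYz
    exact DiEmbed.mem_accessible.2 ⟨P₂, hP₂⟩

theorem IsSwap.card_accessible_lt (h : IsSwap C a y z C') (hzA : C z ∈ accessible C a)
    (hza : C z ≠ a) (hterm : IsTerminal C a (C z))
    (hno : ∀ Y ∈ accessible C a, Y ≠ C z → ¬ IsFree C z Y) (hXA : X ∉ accessible C a)
    (hy' : y' ∈ outer C a) (hne : y ≠ y') (hyy' : ¬ G.Adj y y') (hsolo : Solo C y' z) :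
    #(accessible C a) < #(accessible (recolor C' z X hG hX) a) := by
  have hzA₁ := h.mem_accessible hzA hza hterm hno hXA (hG := hG) (hX := hX)
  have hy'z : y' ≠ z := by
    rintro rfl
    exact mem_outer.1 hy' hzA
  have hy'A : recolor C' z X hG hX y' ∉ accessible C a := by
    rw [recolor_of_ne hy'z]
    exact h.stay y' hy' hne.symm
  have hfree : IsFree (recolor C' z X hG hX) y' (C z) := fun w hw hadj => by
    obtain ⟨hwz, hwC | rfl⟩ := h.eq_or_of_recolor_mem hXA (hw ▸ hzA)
    · exact hwz (hsolo.2 w (hwC ▸ hw) hadj)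
    · exact hyy' hadj.symm
  have hy'₁ : recolor C' z X hG hX y' ∈ accessible (recolor C' z X hG hX) a := by
    by_contra hy'₁
    exact not_isFree_of_notMem_accessible hy'₁ hzA₁ hfree
  refine Finset.card_lt_card ⟨fun Y hY => ?_, fun hsub => hy'A (hsub hy'₁)⟩
  by_cases hYz : Y = C z
  · exact hYz ▸ hzA₁
  · obtain ⟨P, hP, hzP⟩ := hterm Y hY hYz
    exact DiEmbed.mem_accessible.2 ⟨P, h.route hP hzP fun hX => absurd hX hXA⟩

end Swap

section EquitableColoring

universe u v

variable {U : Type u} {ι : Type v} [Fintype U] [Fintype ι] {G : SimpleGraph U} {C : G.Coloring ι}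
  {a b : ι} {s : ℕ}

/-- Every graph with `s` vertices for each colour in `ι` and degrees less than the number of
colours has a proper colouring with classes of size `s`; only used to phrase the induction. -/
def EquitablyColors (ι : Type*) [Fintype ι] (s : ℕ) : Prop :=
  ∀ (U : Type u) [Fintype U] (G : SimpleGraph U), Fintype.card U = Fintype.card ι * s →
    (∀ x, degreeIn G Finset.univ x < Fintype.card ι) →
    ∃ C : G.Coloring ι, ∀ i, #(classOf C i) = s

open Classical in
theorem exists_coloring_outer_erase {y : U}
    (hdeg : ∀ x, degreeIn G Finset.univ x < Fintype.card ι) (hC : NearlyEquitable C s a b)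
    (hb : b ∉ accessible C a) (hy : y ∈ outer C a)
    (ih : ∀ (p : ι → Prop) [DecidablePred p], ¬ p a → EquitablyColors.{u} {i // p i} s) :
    ∃ D : (G.induce ((outer C a).erase y : Set U)).Coloring {i // i ∉ accessible C a},
      ∀ i, #(classOf D i) = s := by
  refine ih (· ∉ accessible C a) (not_not.2 sink_mem_accessible) _ _ ?_ fun x => ?_ <;>
    rw [Fintype.card_of_subtype (accessible C a)ᶜ fun _ => Finset.mem_compl]
  · refine (Fintype.card_coe _).trans ?_
    rw [Finset.card_erase_of_mem hy, hC.card_outer hb, Nat.add_sub_cancel]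
  · have hle : degreeIn (G.induce ((outer C a).erase y : Set U)) Finset.univ x ≤
        degreeIn G (outer C a) x :=
      Finset.card_le_card_of_injOn (↑) (fun w hw => by
        simp only [Finset.coe_filter, Finset.mem_univ, true_and, Set.mem_ofPred_eq] at hw
        exact Finset.mem_coe.2 (Finset.mem_filter.2 ⟨Finset.mem_of_mem_erase w.2, hw⟩))
        Subtype.val_injective.injOn
    have := degreeIn_outer_add_card_lt hdeg (x := x) subset_rfl fun X hX =>
      not_isFree_of_notMem_accessible (mem_outer.1 (Finset.mem_of_mem_erase x.2)) hX
    have := Finset.card_compl_add_card (accessible C a)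
    omega

theorem NearlyEquitable.exists_improvement
    (hdeg : ∀ x, degreeIn G Finset.univ x < Fintype.card ι) (hC : NearlyEquitable C s a b)
    (hb : b ∉ accessible C a)
    (ih : ∀ (p : ι → Prop) [DecidablePred p], ¬ p a → EquitablyColors.{u} {i // p i} s) :
    ∃ (C' : G.Coloring ι) (b' : ι), NearlyEquitable C' s a b' ∧
      (b' ∈ accessible C' a ∨ #(accessible C a) < #(accessible C' a)) := by
  have hG (z u v : U) (hu : u ≠ z) (hv : v ≠ z) (huv : G.Adj u v) :
      (G.deleteIncidenceSet z).Adj u v := SimpleGraph.deleteIncidenceSet_adj.2 ⟨huv, hu, hv⟩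
  obtain ⟨Z, hZ, hne, hterm⟩ := exists_terminal_dominated (hC.accessible_ne_singleton hdeg hb)
  have hsub := dominated_subset_accessible (C := C) (a := a) (Z := Z)
  have hswap (y z : U) (hy : y ∈ outer C a) (hz : C z ∈ dominated C a Z) (hyz : Solo C y z) :
      ∃ C' : (G.deleteIncidenceSet z).Coloring ι, IsSwap C a y z C' ∧
        NearlyEquitable C' s a (C' z) := by
    obtain ⟨D, hD⟩ := exists_coloring_outer_erase hdeg hC hb hy ih
    obtain ⟨C', hC', hout⟩ := exists_isSwap hy (hsub hz) hyz D hD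
    exact ⟨C', hC', hC'.keep z (hsub hz) ▸ hC'.nearlyEquitable hC hb hy (hsub hz) hout⟩
  by_cases hno : NoMovableSolo C a (dominated C a Z)
  · obtain ⟨z, y, y', hz, hy, hy', hyy', hadj, hyz, hy'z⟩ :=
      hno.exists_solo_pair hdeg hC hb hZ hne
    obtain ⟨C', hC', hnear⟩ := hswap y z hy hz hyz
    obtain ⟨X, hXA, hX⟩ := hC'.exists_free hdeg hy (hsub hz) hyz.1 (hno y hy z hz hyz)
    exact ⟨DiEmbed.recolor C' z X (hG z) hX, X, hnear.recolor, .inr <|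
      hC'.card_accessible_lt (hsub hz) (fun h => sink_notMem_dominated (h ▸ hz)) (hterm _ hz)
        (hno y hy z hz hyz) hXA hy' hyy' hadj hy'z⟩
  · simp only [NoMovableSolo, not_forall, not_not] at hno
    obtain ⟨y, hy, z, hz, hyz, X, hXA, hXz, hfree⟩ := hno
    obtain ⟨C', hC', hnear⟩ := hswap y z hy hz hyz
    obtain ⟨P, hP, hzP⟩ := hterm _ hz X hXA hXz
    have hX (w : U) (_ : w ≠ z) (hw : C' w = X) : ¬ G.Adj z w := by
      by_cases hwA : C w ∈ accessible C a
      · exact hfree w (hC'.keep w hwA ▸ hw)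
      · by_cases hwy : w = y
        · exact absurd (hw.symm.trans (hwy ▸ hC'.moved)) hXz
        · exact absurd (hw ▸ hXA) (hC'.stay w (mem_outer.2 hwA) hwy)
    exact ⟨DiEmbed.recolor C' z X (hG z) hX, X, hnear.recolor, .inl <|
      mem_accessible.2 ⟨P, hC'.route hP hzP fun _ => rfl⟩⟩

theorem NearlyEquitable.exists_equitable
    (hdeg : ∀ x, degreeIn G Finset.univ x < Fintype.card ι) (hC : NearlyEquitable C s a b)
    (ih : ∀ (p : ι → Prop) [DecidablePred p], ¬ p a → EquitablyColors.{u} {i // p i} s) :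
    ∃ C' : G.Coloring ι, ∀ i, #(classOf C' i) = s := by
  induction hm : Fintype.card ι - #(accessible C a) using Nat.strong_induction_on
    generalizing C b with
  | _ m ihm =>
    by_cases hb : b ∈ accessible C a
    · obtain ⟨P, hP⟩ := mem_accessible.1 hb
      exact hP.exists_equitable hC
    obtain ⟨C₁, b₁, hC₁, hb₁⟩ := hC.exists_improvement hdeg hb ih
    by_cases hb₁A : b₁ ∈ accessible C₁ a
    · obtain ⟨P, hP⟩ := mem_accessible.1 hb₁A
      exact hP.exists_equitable hC₁
    have := hb₁.resolve_left hb₁A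
    have := Finset.card_le_univ (accessible C₁ a)
    exact ihm _ (by omega) hC₁ rfl

theorem exists_nearlyEquitable_of_deleteIncidenceSet {u : U}
    (hdeg : ∀ x, degreeIn G Finset.univ x < Fintype.card ι)
    (D : (G.deleteIncidenceSet u).Coloring ι) (hD : ∀ i, #(classOf D i) = s) :
    ∃ (C : G.Coloring ι) (a b : ι), NearlyEquitable C s a b := by
  classical
  obtain ⟨i, hi⟩ : ∃ i, i ∉ ({w | G.Adj u w} : Finset U).image D := by
    by_contra! h
    have := Finset.card_le_card fun i (_ : i ∈ Finset.univ) => h i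
    exact (this.trans Finset.card_image_le).not_gt (hdeg u)
  have hi' (w : U) (hw : D w = i) : ¬ G.Adj u w := fun huw =>
    hi (Finset.mem_image.2 ⟨w, by simpa using huw, hw⟩)
  have hD' : NearlyEquitable D s (D u) (D u) := fun j => by rw [hD]
  exact ⟨recolor D u i (fun v w hv hw h => SimpleGraph.deleteIncidenceSet_adj.2 ⟨h, hv, hw⟩)
    fun w _ => hi' w, _, _, hD'.recolor⟩

theorem equitablyColors (ι : Type v) [Fintype ι] (s : ℕ) : EquitablyColors.{u} ι s := by
  classical
  induction hk : Fintype.card ι using Nat.strong_induction_on generalizing ι with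
  | _ k ih =>
    subst hk
    intro U _ G hU
    induction G using WellFoundedLT.induction with
    | _ G ihG =>
      intro hdeg
      rcases eq_or_ne G ⊥ with rfl | hG
      · let e : U ≃ ι × Fin s := Fintype.equivOfCardEq (by simp [hU])
        let C : (⊥ : SimpleGraph U).Coloring ι := .mk (fun v => (e v).1) fun h => h.elim
        refine ⟨C, fun i => ?_⟩
        have hmem (v : U) : v ∈ classOf C i ↔ e v ∈ ({i} : Finset ι) ×ˢ Finset.univ := by
          rw [mem_classOf, Finset.mem_product, Finset.mem_singleton]
          exact (and_iff_left (Finset.mem_univ _)).symm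
        simp [Finset.card_equiv e hmem]
      · obtain ⟨u, v, huv⟩ := SimpleGraph.ne_bot_iff_exists_adj.1 hG
        have hlt : G.deleteIncidenceSet u < G :=
          (SimpleGraph.deleteIncidenceSet_le G u).lt_of_ne fun h =>
            (SimpleGraph.deleteIncidenceSet_adj.1 (h.symm ▸ huv)).2.1 rfl
        obtain ⟨D, hD⟩ := ihG _ hlt fun x =>
          (degreeIn_mono hlt.le).trans_lt (hdeg x)
        obtain ⟨C, a, b, hC⟩ := exists_nearlyEquitable_of_deleteIncidenceSet hdeg D hD
        exact hC.exists_equitable hdeg fun p _ hp => ih _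
          (Fintype.card_subtype_lt hp) _ rfl

theorem exists_coloring_div_le_card_classOf
    (hdeg : ∀ x, degreeIn G Finset.univ x < Fintype.card ι) :
    ∃ C : G.Coloring ι, ∀ i, Fintype.card U / Fintype.card ι ≤ #(classOf C i) := by
  classical
  rcases isEmpty_or_nonempty ι with hι | hι
  · have : IsEmpty U := ⟨fun x => by simpa using hdeg x⟩
    exact ⟨SimpleGraph.Coloring.mk isEmptyElim fun {u} => isEmptyElim u, isEmptyElim⟩
  set k := Fintype.card ι
  have hk : 0 < k := Fintype.card_pos
  -- Padding with a clique makes `k` divide the order and puts at most one new vertex in each class.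
  let K : SimpleGraph (Fin (k - Fintype.card U % k)) := ⊤
  have hcard : Fintype.card (U ⊕ Fin (k - Fintype.card U % k)) = k * (Fintype.card U / k + 1) := by
    have := Nat.div_add_mod (Fintype.card U) k
    have := Nat.mod_lt (Fintype.card U) hk
    rw [Fintype.card_sum, Fintype.card_fin, mul_add_one]
    omega
  have hdegree (x : U ⊕ Fin (k - Fintype.card U % k)) : degreeIn (G ⊕g K) Finset.univ x < k := by
    rcases x with x | x
    · exact degreeIn_sum_inl.trans_lt (hdeg x)
    · refine (degreeIn_sum_inr.trans_lt degreeIn_lt_card).trans_le ?_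
      rw [Fintype.card_fin]
      exact Nat.sub_le _ _
  obtain ⟨C, hC⟩ := equitablyColors ι (Fintype.card U / k + 1) _ (G ⊕g K) hcard hdegree
  refine ⟨C.sumLeft, fun i => ?_⟩
  have hsplit : classOf C i = (classOf C.sumLeft i).disjSum (classOf C.sumRight i) := by
    ext (x | x) <;> simp only [mem_classOf, Finset.inl_mem_disjSum, Finset.inr_mem_disjSum] <;> rfl
  have hright : #(classOf C.sumRight i) ≤ 1 := Finset.card_le_one.2 fun x hx y hy => by
    by_contra hxy
    exact C.sumRight.valid hxy ((mem_classOf.1 hx).trans (mem_classOf.1 hy).symm)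
  have := hC i
  rw [hsplit, Finset.card_disjSum] at this
  omega

end EquitableColoring

end HajnalSzemeredi

section IsRare

variable {Ω κ : Type*} {Q : Finset Ω} {P P' : Ω → Prop} {η η' : ℝ}

open Classical in
/-- The event `P` has probability at most `η` under the uniform distribution on `Q`; clearing the
denominator, this also makes sense for `Q = ∅`. -/
def IsRare (Q : Finset Ω) (P : Ω → Prop) (η : ℝ) : Prop := (#{a ∈ Q | P a} : ℝ) ≤ η * #Q

theorem isRare_iff [DecidablePred P] : IsRare Q P η ↔ (#{a ∈ Q | P a} : ℝ) ≤ η * #Q := by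
  unfold IsRare
  convert Iff.rfl

theorem IsRare.mono (h : IsRare Q P η) (hP : ∀ a ∈ Q, P' a → P a) (hη : η ≤ η') :
    IsRare Q P' η' := by
  classical
  have hsub : ({a ∈ Q | P' a} : Finset Ω) ⊆ {a ∈ Q | P a} := fun a ha =>
    have ha := Finset.mem_filter.1 ha
    Finset.mem_filter.2 ⟨ha.1, hP a ha.1 ha.2⟩
  calc (#{a ∈ Q | P' a} : ℝ) ≤ #{a ∈ Q | P a} := by exact_mod_cast Finset.card_le_card hsub
    _ ≤ η * #Q := h
    _ ≤ η' * #Q := by gcongr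

theorem isRare_of_one_le (hη : 1 ≤ η) : IsRare Q P η := by
  classical
  have h : (#{a ∈ Q | P a} : ℝ) ≤ #Q := by exact_mod_cast Finset.card_filter_le Q P
  exact h.trans (le_mul_of_one_le_left (Nat.cast_nonneg _) hη)

theorem isRare_of_forall_not (hη : 0 ≤ η) (h : ∀ a ∈ Q, ¬ P a) : IsRare Q P η := by
  classical
  rw [isRare_iff, Finset.filter_eq_empty_iff.2 fun a ha => h a ha, Finset.card_empty]
  push_cast
  positivity

theorem IsRare.or (h : IsRare Q P η) (h' : IsRare Q P' η') :
    IsRare Q (fun a => P a ∨ P' a) (η + η') := by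
  classical
  rw [isRare_iff] at h h' ⊢
  calc (#{a ∈ Q | P a ∨ P' a} : ℝ) ≤ #{a ∈ Q | P a} + #{a ∈ Q | P' a} := by
        rw [Finset.filter_or]
        exact_mod_cast Finset.card_union_le _ _
    _ ≤ (η + η') * #Q := by rw [add_mul]; exact add_le_add h h'

theorem IsRare.and [DecidablePred P] (h : IsRare Q P η) (h' : IsRare {a ∈ Q | P a} P' η')
    (hη' : 0 ≤ η') : IsRare Q (fun a => P a ∧ P' a) (η * η') := by
  classical
  rw [isRare_iff] at h h' ⊢
  calc (#{a ∈ Q | P a ∧ P' a} : ℝ) = #{a ∈ {a ∈ Q | P a} | P' a} := by rw [Finset.filter_filter]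
    _ ≤ η' * (η * #Q) := h'.trans (mul_le_mul_of_nonneg_left h hη')
    _ = η * η' * #Q := by ring

theorem IsRare.exists_mem {s : Finset κ} {P : κ → Ω → Prop} {η : κ → ℝ}
    (h : ∀ i ∈ s, IsRare Q (P i) (η i)) : IsRare Q (fun a => ∃ i ∈ s, P i a) (∑ i ∈ s, η i) := by
  classical
  have hsub : ({a ∈ Q | ∃ i ∈ s, P i a} : Finset Ω) ⊆ s.biUnion fun i => {a ∈ Q | P i a} := by
    intro a ha
    simp only [Finset.mem_biUnion, Finset.mem_filter] at ha ⊢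
    tauto
  rw [isRare_iff]
  calc (#{a ∈ Q | ∃ i ∈ s, P i a} : ℝ) ≤ ∑ i ∈ s, (#{a ∈ Q | P i a} : ℝ) := by
        exact_mod_cast (Finset.card_le_card hsub).trans Finset.card_biUnion_le
    _ ≤ (∑ i ∈ s, η i) * #Q := by
        rw [Finset.sum_mul]
        exact Finset.sum_le_sum fun i hi => isRare_iff.1 (h i hi)

open Classical in
theorem IsRare.of_fibers (f : Ω → κ) (h : ∀ a₀ ∈ Q, IsRare {a ∈ Q | f a = f a₀} P η) :
    IsRare Q P η := by
  have hfiber (t : κ) (ht : t ∈ Q.image f) :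
      (#{a ∈ {a ∈ Q | P a} | f a = t} : ℝ) ≤ η * #{a ∈ Q | f a = t} := by
    obtain ⟨a₀, ha₀, rfl⟩ := Finset.mem_image.1 ht
    rw [Finset.filter_comm]
    exact h a₀ ha₀
  calc (#{a ∈ Q | P a} : ℝ) = ∑ t ∈ Q.image f, (#{a ∈ {a ∈ Q | P a} | f a = t} : ℝ) := by
        exact_mod_cast Finset.card_eq_sum_card_fiberwise fun a ha =>
          Finset.mem_image_of_mem f (Finset.mem_filter.1 ha).1
    _ ≤ ∑ t ∈ Q.image f, η * #{a ∈ Q | f a = t} := Finset.sum_le_sum hfiber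
    _ = η * #Q := by
        rw [← Finset.mul_sum, Finset.card_eq_sum_card_image f Q]
        push_cast
        rfl

theorem IsRare.comap_equiv {Ω' : Type*} {Q' : Finset Ω'} (h : IsRare Q P η) (e : Ω' ≃ Ω)
    (hQ : ∀ a, a ∈ Q' ↔ e a ∈ Q) : IsRare Q' (fun a => P (e a)) η := by
  classical
  rw [isRare_iff] at h ⊢
  rwa [Finset.card_equiv e hQ,
    Finset.card_equiv (t := {a ∈ Q | P a}) e fun a => by simp only [Finset.mem_filter, hQ]]

end IsRare

section Matching

variable {Ω α β : Type*} {Q : Finset Ω} {rel : Ω → α → β → Prop} {p : ℝ}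

/-- No element of `X` is related to an element of `Y`. -/
def Unrelated (r : α → β → Prop) (X : Finset α) (Y : Finset β) : Prop :=
  ∀ u ∈ X, ∀ v ∈ Y, ¬ r u v

/-- The relation `rel a`, for `a` uniformly random in `Q`, avoids `X × Y` with the probability
`(1 - p) ^ (|X| |Y|)` of independent pairs of density `p`, or less. -/
def IsSpread (Q : Finset Ω) (rel : Ω → α → β → Prop) (p : ℝ) : Prop :=
  ∀ X Y, IsRare Q (fun a => Unrelated (rel a) X Y) ((1 - p) ^ (#X * #Y))

theorem IsSpread.swap (hs : IsSpread Q rel p) : IsSpread Q (fun a v u => rel a u v) p :=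
  fun X Y => (hs Y X).mono (fun _ _ h u hu v hv => h v hv u hu) (by rw [mul_comm])

/-- The relation `r` contains the graph of an injective function. -/
def HasMatching (r : α → β → Prop) : Prop :=
  ∃ f : α → β, Function.Injective f ∧ ∀ u, r u (f u)

variable [Fintype β]

open Classical in
/-- The elements related to some element of `X`. -/
noncomputable def related (r : α → β → Prop) (X : Finset α) : Finset β := {v | ∃ u ∈ X, r u v}

theorem mem_related {r : α → β → Prop} {X : Finset α} {v : β} :
    v ∈ related r X ↔ ∃ u ∈ X, r u v := by
  simp [related]

open Classical in
theorem subset_compl_related_iff {r : α → β → Prop} {X : Finset α} {Y : Finset β} :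
    Y ⊆ (related r X)ᶜ ↔ Unrelated r X Y := by
  simp only [Finset.subset_iff, Finset.mem_compl, mem_related, not_exists, not_and, Unrelated]
  exact ⟨fun h u hu v hv => h hv u hu, fun h v hv u hu => h u hu v hv⟩

open Classical in
theorem pow_card_related (r : α → β → Prop) (X : Finset α) (z : ℝ) :
    z ^ #(related r X) = ∑ Y : Finset β, (1 - z) ^ #Y * z ^ (Fintype.card β - #Y) *
      if Unrelated r X Y then 1 else 0 := by
  set R := related r X
  have hpowerset : (Finset.univ.filter fun Y => Unrelated r X Y) = Rᶜ.powerset := by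
    ext Y
    simp [R, subset_compl_related_iff]
  have hbinom := Finset.sum_pow_mul_eq_add_pow (1 - z) z Rᶜ
  rw [sub_add_cancel, one_pow] at hbinom
  simp only [mul_ite, mul_one, mul_zero]
  rw [← Finset.sum_filter, hpowerset]
  calc z ^ #R = ∑ Y ∈ Rᶜ.powerset, z ^ #R * ((1 - z) ^ #Y * z ^ (#Rᶜ - #Y)) := by
        rw [← Finset.mul_sum, hbinom, mul_one]
    _ = ∑ Y ∈ Rᶜ.powerset, (1 - z) ^ #Y * z ^ (Fintype.card β - #Y) := by
        refine Finset.sum_congr rfl fun Y hY => ?_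
        have hYR : #Y ≤ #Rᶜ := Finset.card_le_card (Finset.mem_powerset.1 hY)
        have hR : #R + #Rᶜ = Fintype.card β := Finset.card_add_card_compl R
        rw [mul_left_comm, ← pow_add]
        congr 2
        omega

theorem IsSpread.sum_pow_card_related_le (hs : IsSpread Q rel p) (X : Finset α) {z : ℝ}
    (hz0 : 0 ≤ z) (hz1 : z ≤ 1) :
    ∑ a ∈ Q, z ^ #(related (rel a) X) ≤ ((1 - z) * (1 - p) ^ #X + z) ^ Fintype.card β * #Q := by
  classical
  simp only [pow_card_related]
  rw [Finset.sum_comm, ← Fintype.sum_pow_mul_eq_add_pow, Finset.sum_mul]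
  refine Finset.sum_le_sum fun Y _ => ?_
  rw [← Finset.mul_sum, Finset.sum_boole]
  have := sub_nonneg.2 hz1
  calc _ ≤ (1 - z) ^ #Y * z ^ (Fintype.card β - #Y) * ((1 - p) ^ (#X * #Y) * #Q) :=
        mul_le_mul_of_nonneg_left (isRare_iff.1 (hs X Y)) (by positivity)
    _ = _ := by rw [mul_pow, ← pow_mul]; ring

theorem one_sub_pow_le_exp (hp1 : p ≤ 1) (n : ℕ) : (1 - p) ^ n ≤ Real.exp (-(p * n)) := by
  calc (1 - p) ^ n ≤ Real.exp (-p) ^ n :=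
        pow_le_pow_left₀ (sub_nonneg.2 hp1) (Real.one_sub_le_exp_neg p) n
    _ = Real.exp (-(p * n)) := by rw [← Real.exp_nat_mul]; ring_nf

theorem exp_neg_le_one_sub {t : ℝ} (ht0 : 0 ≤ t) (ht : t ≤ 1 / 20) :
    Real.exp (-t) ≤ 1 - 19 / 20 * t := by
  have ht1 : |-t| ≤ 1 := by
    rw [abs_neg, abs_of_nonneg ht0]
    linarith
  have h := (abs_le.1 (Real.abs_exp_sub_one_sub_id_le ht1)).2
  nlinarith

-- Markov's inequality for the generating function `20 ^ (-|related X|)`.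
theorem IsSpread.isRare_card_related_lt (hs : IsSpread Q rel p) (hp0 : 0 ≤ p) (hp1 : p ≤ 1)
    {X : Finset α} (hX : p * #X ≤ 1 / 20) :
    IsRare Q (fun a => #(related (rel a) X) < #X)
      ((20 * Real.exp (-(9 / 10 * (Fintype.card β * p)))) ^ #X) := by
  classical
  set x := #X
  set k := Fintype.card β
  have hmarkov : (1 / 20 : ℝ) ^ x * #{a ∈ Q | #(related (rel a) X) < x} ≤
      ∑ a ∈ Q, (1 / 20 : ℝ) ^ #(related (rel a) X) := by
    refine le_trans ?_ (Finset.sum_le_sum_of_subset_of_nonneg (Finset.filter_subset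
      (fun a => #(related (rel a) X) < x) Q) fun _ _ _ => by positivity)
    rw [mul_comm, ← nsmul_eq_mul]
    refine Finset.card_nsmul_le_sum _ _ _ fun a ha => ?_
    exact pow_le_pow_of_le_one (by norm_num) (by norm_num) (Finset.mem_filter.1 ha).2.le
  have ht : 0 ≤ p * x := by positivity
  have hbase : (1 - 1 / 20) * (1 - p) ^ x + 1 / 20 ≤ Real.exp (-(9 / 10 * (p * x))) := by
    have := one_sub_pow_le_exp hp1 x
    have := exp_neg_le_one_sub ht hX
    have := Real.one_sub_le_exp_neg (9 / 10 * (p * x))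
    linarith
  have hpos : 0 ≤ (1 - 1 / 20) * (1 - p) ^ x + 1 / 20 := by
    have := pow_nonneg (sub_nonneg.2 hp1) x
    positivity
  have hpow : ((1 - 1 / 20) * (1 - p) ^ x + 1 / 20) ^ k ≤
      Real.exp (-(9 / 10 * (k * p))) ^ x := by
    calc _ ≤ Real.exp (-(9 / 10 * (p * x))) ^ k := pow_le_pow_left₀ hpos hbase k
      _ = _ := by rw [← Real.exp_nat_mul, ← Real.exp_nat_mul]; ring_nf
  have h20 : (20 : ℝ) ^ x * (1 / 20) ^ x = 1 := by rw [← mul_pow]; norm_num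
  rw [isRare_iff, mul_pow]
  calc (#{a ∈ Q | #(related (rel a) X) < x} : ℝ)
      = 20 ^ x * ((1 / 20) ^ x * #{a ∈ Q | #(related (rel a) X) < x}) := by
        rw [← mul_assoc, h20, one_mul]
    _ ≤ 20 ^ x * (Real.exp (-(9 / 10 * (k * p))) ^ x * #Q) := by
        refine mul_le_mul_of_nonneg_left (hmarkov.trans ?_) (by positivity)
        refine (hs.sum_pow_card_related_le X (by norm_num) (by norm_num)).trans ?_
        exact mul_le_mul_of_nonneg_right hpow (Nat.cast_nonneg _)
    _ = _ := (mul_assoc ..).symm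

theorem choose_le_exp_mul_div_pow {k x : ℕ} (hx : 0 < x) :
    (k.choose x : ℝ) ≤ (Real.exp 1 * (k / x)) ^ x := by
  have hx' : (0 : ℝ) < x := Nat.cast_pos.2 hx
  calc (k.choose x : ℝ) ≤ k ^ x / x.factorial := Nat.choose_le_pow_div x k
    _ = (k / x : ℝ) ^ x * (x ^ x / x.factorial) := by rw [div_pow]; field_simp
    _ ≤ (k / x : ℝ) ^ x * Real.exp x := by
        gcongr
        exact Real.pow_div_factorial_le_exp _ hx'.le x
    _ = (Real.exp 1 * (k / x)) ^ x := by
        rw [mul_pow, ← Real.exp_nat_mul, mul_one, mul_comm]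

theorem choose_le_choose_succ {k x : ℕ} (hx : 2 * x < k) : k.choose x ≤ k.choose (x + 1) := by
  refine Nat.le_of_mul_le_mul_right ?_ x.succ_pos
  rw [Nat.succ_eq_add_one, Nat.choose_succ_right_eq]
  exact Nat.mul_le_mul_left _ (by omega)

theorem choose_le_pow_of_le_mul {k x : ℕ} (hx0 : 0 < x) (hx : 1 / 20 ≤ p * x) :
    (k.choose x : ℝ) ≤ (55 * (k * p)) ^ x := by
  have hx' : (0 : ℝ) < x := Nat.cast_pos.2 hx0
  have hdiv : (k : ℝ) / x ≤ 20 * (k * p) := by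
    rw [div_le_iff₀ hx']
    nlinarith [k.cast_nonneg (α := ℝ)]
  refine (choose_le_exp_mul_div_pow hx0).trans (pow_le_pow_left₀ (by positivity) ?_ _)
  calc Real.exp 1 * (k / x) ≤ 2.75 * (20 * (k * p)) := by
        gcongr
        exact Real.exp_one_lt_d9.le.trans (by norm_num)
    _ = 55 * (k * p) := by ring

variable [Fintype α]

theorem IsSpread.isRare_exists_card_related_lt_of_small (hs : IsSpread Q rel p) (hp0 : 0 ≤ p)
    (hp1 : p ≤ 1) (hcard : Fintype.card α = Fintype.card β) {x : ℕ} (hx : p * x ≤ 1 / 20) :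
    IsRare Q (fun a => ∃ X, #X = x ∧ #(related (rel a) X) < x)
      ((20 * Fintype.card β * Real.exp (-(9 / 10 * (Fintype.card β * p)))) ^ x) := by
  set k := Fintype.card β
  refine (IsRare.exists_mem (s := Finset.powersetCard x Finset.univ)
    (P := fun X a => #(related (rel a) X) < #X)
    (η := fun _ => (20 * Real.exp (-(9 / 10 * (k * p)))) ^ x) fun X hX => ?_).mono ?_ ?_
  · have hX := (Finset.mem_powersetCard.1 hX).2
    exact (hs.isRare_card_related_lt hp0 hp1 (X := X) (hX ▸ hx)).mono (fun _ _ h => h) (by rw [hX])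
  · rintro a - ⟨X, hX, hlt⟩
    exact ⟨X, Finset.mem_powersetCard.2 ⟨Finset.subset_univ X, hX⟩, hX ▸ hlt⟩
  · rw [Finset.sum_const, Finset.card_powersetCard, Finset.card_univ, hcard, nsmul_eq_mul]
    calc (k.choose x : ℝ) * (20 * Real.exp (-(9 / 10 * (k * p)))) ^ x ≤
          (k : ℝ) ^ x * (20 * Real.exp (-(9 / 10 * (k * p)))) ^ x := by
          gcongr
          exact_mod_cast Nat.choose_le_pow k x
      _ = _ := by rw [← mul_pow]; ring

theorem IsSpread.isRare_exists_card_related_lt_of_large (hs : IsSpread Q rel p)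
    (hp1 : p ≤ 1) (hcard : Fintype.card α = Fintype.card β) {x : ℕ} (hx0 : 0 < x)
    (hx : 1 / 20 ≤ p * x) (hxk : 2 * x ≤ Fintype.card β + 1) :
    IsRare Q (fun a => ∃ X, #X = x ∧ #(related (rel a) X) < x)
      (((55 * (Fintype.card β * p)) ^ 2 * Real.exp (-(Fintype.card β * p / 2))) ^ x) := by
  classical
  set k := Fintype.card β
  refine (IsRare.exists_mem
    (s := Finset.powersetCard x Finset.univ ×ˢ Finset.powersetCard (k + 1 - x) Finset.univ)
    (P := fun XY a => Unrelated (rel a) XY.1 XY.2)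
    (η := fun _ => (1 - p) ^ (x * (k + 1 - x))) fun XY hXY => ?_).mono ?_ ?_
  · simp only [Finset.mem_product, Finset.mem_powersetCard] at hXY
    exact (hs XY.1 XY.2).mono (fun _ _ h => h) (by rw [hXY.1.2, hXY.2.2])
  · rintro a - ⟨X, hX, hlt⟩
    obtain ⟨Y, hY, hYcard⟩ := Finset.exists_subset_card_eq (s := (related (rel a) X)ᶜ)
      (n := k + 1 - x) (by rw [Finset.card_compl]; omega)
    exact ⟨(X, Y), by simp [Finset.mem_powersetCard, hX, hYcard], subset_compl_related_iff.1 hY⟩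
  · have hx' : (0 : ℝ) < x := Nat.cast_pos.2 hx0
    have hp0 : 0 ≤ p := by
      by_contra! hp
      nlinarith
    have hchoose : (k.choose x : ℝ) ≤ (55 * (k * p)) ^ x := choose_le_pow_of_le_mul hx0 hx
    have hchoose' : (k.choose (k + 1 - x) : ℝ) ≤ (55 * (k * p)) ^ x := by
      refine le_trans ?_ hchoose
      obtain ⟨y, rfl⟩ := Nat.exists_eq_add_one_of_ne_zero hx0.ne'
      rw [Nat.add_sub_add_right, Nat.choose_symm (by omega)]
      exact_mod_cast choose_le_choose_succ (by omega)
    have hexp : (1 - p) ^ (x * (k + 1 - x)) ≤ Real.exp (-(k * p / 2)) ^ x := by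
      have hhalf : (k : ℝ) ≤ 2 * (k + 1 - x : ℕ) := by exact_mod_cast (by omega)
      rw [mul_comm x, pow_mul]
      refine pow_le_pow_left₀ (pow_nonneg (sub_nonneg.2 hp1) _) ?_ _
      refine (one_sub_pow_le_exp hp1 _).trans (Real.exp_le_exp.2 ?_)
      nlinarith
    have := pow_nonneg (sub_nonneg.2 hp1) (x * (k + 1 - x))
    rw [Finset.sum_const, Finset.card_product, Finset.card_powersetCard, Finset.card_powersetCard,
      Finset.card_univ, Finset.card_univ, hcard, nsmul_eq_mul, Nat.cast_mul]
    calc (k.choose x : ℝ) * k.choose (k + 1 - x) * (1 - p) ^ (x * (k + 1 - x)) ≤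
          (55 * (k * p)) ^ x * (55 * (k * p)) ^ x * Real.exp (-(k * p / 2)) ^ x := by gcongr
      _ = _ := by rw [mul_pow _ (Real.exp _), ← pow_mul, mul_comm 2, pow_mul, sq, mul_pow]

/-- A bound, up to a constant factor, for the probability that Hall's condition fails for a random
relation of density `p` between two sets of size `k`. The first term accounts for the sets of size
at most `1 / (20 * p)`, the second one for the larger sets. -/
noncomputable def hallFailure (k : ℕ) (p : ℝ) : ℝ :=
  20 * k * Real.exp (-(9 / 10 * (k * p))) + (55 * (k * p)) ^ 2 * Real.exp (-(k * p / 2))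

theorem hallFailure_nonneg (k : ℕ) (p : ℝ) : 0 ≤ hallFailure k p := by
  unfold hallFailure
  positivity

theorem IsSpread.isRare_exists_card_related_lt (hs : IsSpread Q rel p) (hp0 : 0 ≤ p) (hp1 : p ≤ 1)
    (hcard : Fintype.card α = Fintype.card β) {x : ℕ} (hx0 : 0 < x)
    (hxk : 2 * x ≤ Fintype.card β + 1) :
    IsRare Q (fun a => ∃ X, #X = x ∧ #(related (rel a) X) < x)
      (hallFailure (Fintype.card β) p ^ x) := by
  rcases le_total (p * x) (1 / 20) with hx | hx
  · refine (hs.isRare_exists_card_related_lt_of_small hp0 hp1 hcard hx).mono (fun _ _ h => h) ?_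
    exact pow_le_pow_left₀ (by positivity) (le_add_of_nonneg_right (by positivity)) _
  · refine (hs.isRare_exists_card_related_lt_of_large hp1 hcard hx0 hx hxk).mono
      (fun _ _ h => h) ?_
    exact pow_le_pow_left₀ (by positivity) (le_add_of_nonneg_left (by positivity)) _

theorem IsSpread.isRare_exists_small_card_related_lt (hs : IsSpread Q rel p) (hp0 : 0 ≤ p)
    (hp1 : p ≤ 1) (hcard : Fintype.card α = Fintype.card β) :
    IsRare Q (fun a => ∃ X, 2 * #X ≤ Fintype.card β + 1 ∧ #(related (rel a) X) < #X)
      (2 * hallFailure (Fintype.card β) p) := by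
  set k := Fintype.card β
  set r := hallFailure k p
  have hr0 : 0 ≤ r := hallFailure_nonneg k p
  rcases le_total (1 / 2) r with hr | hr
  · exact isRare_of_one_le (by linarith)
  refine (IsRare.exists_mem (s := {x ∈ Finset.Ico 1 (k + 1) | 2 * x ≤ k + 1}) (κ := ℕ)
    (P := fun x a => ∃ X, #X = x ∧ #(related (rel a) X) < x) (η := (r ^ ·))
    fun x hx => ?_).mono ?_ ?_
  · simp only [Finset.mem_filter, Finset.mem_Ico] at hx
    exact hs.isRare_exists_card_related_lt hp0 hp1 hcard hx.1.1 hx.2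
  · rintro a - ⟨X, hX, hlt⟩
    exact ⟨#X, Finset.mem_filter.2 ⟨Finset.mem_Ico.2 (by omega), hX⟩, X, rfl, hlt⟩
  · calc _ ≤ ∑ x ∈ Finset.Ico 1 (k + 1), r ^ x :=
          Finset.sum_le_sum_of_subset_of_nonneg (Finset.filter_subset _ _)
            fun _ _ _ => by positivity
      _ ≤ r ^ 1 / (1 - r) := geom_sum_Ico_le_of_lt_one hr0 (by linarith)
      _ ≤ 2 * r := by
          rw [pow_one, div_le_iff₀ (by linarith)]
          nlinarith

-- If `X` is deficient and large, the complement of `related r X` is deficient and small.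
theorem exists_small_deficient (hcard : Fintype.card α = Fintype.card β) {r : α → β → Prop}
    (hno : ¬ HasMatching r) :
    (∃ X, 2 * #X ≤ Fintype.card β + 1 ∧ #(related r X) < #X) ∨
      ∃ Y, 2 * #Y ≤ Fintype.card α + 1 ∧ #(related (fun v u => r u v) Y) < #Y := by
  classical
  rw [HasMatching, ← Fintype.all_card_le_filter_rel_iff_exists_injective] at hno
  push Not at hno
  obtain ⟨X, hX⟩ := hno
  have hrelated : related r X = ({v | ∃ u ∈ X, r u v} : Finset β) := by
    ext
    simp [mem_related]
  rw [← hrelated] at hX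
  by_cases hXs : 2 * #X ≤ Fintype.card β + 1
  · exact .inl ⟨X, hXs, hX⟩
  have hXcard := Finset.card_le_univ X
  obtain ⟨Y, hY, hYcard⟩ := Finset.exists_subset_card_eq (s := (related r X)ᶜ)
    (n := Fintype.card α + 1 - #X) (by rw [Finset.card_compl]; omega)
  refine .inr ⟨Y, by omega, ?_⟩
  have hsub : related (fun v u => r u v) Y ⊆ Xᶜ := fun u hu => by
    obtain ⟨v, hv, huv⟩ := mem_related.1 hu
    exact Finset.mem_compl.2 fun huX => subset_compl_related_iff.1 hY u huX v hv huv
  have := Finset.card_le_card hsub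
  rw [Finset.card_compl] at this
  omega

theorem IsSpread.isRare_not_hasMatching (hs : IsSpread Q rel p) (hp0 : 0 ≤ p) (hp1 : p ≤ 1)
    (hcard : Fintype.card α = Fintype.card β) :
    IsRare Q (fun a => ¬ HasMatching (rel a)) (4 * hallFailure (Fintype.card α) p) :=
  ((hs.isRare_exists_small_card_related_lt hp0 hp1 hcard).or
    (hs.swap.isRare_exists_small_card_related_lt hp0 hp1 hcard.symm)).mono
    (fun _ _ => exists_small_deficient hcard) (by rw [hcard]; linarith)

end Matching

section Tables

variable {I κ : Type*} {Q : Finset (I → Bool)} {P : (I → Bool) → Prop} {η : ℝ}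

/-- Membership in `Q` does not depend on the coordinates in `T`: the coordinates in `T` of a
uniformly random element of `Q` are fair coin tosses, independent of the other ones. -/
def InvariantOn (T : Set I) (Q : Finset (I → Bool)) : Prop :=
  ∀ a b, Set.EqOn a b Tᶜ → a ∈ Q → b ∈ Q

theorem InvariantOn.mono {T T' : Set I} (hQ : InvariantOn T Q) (hT : T' ⊆ T) :
    InvariantOn T' Q :=
  fun a b hab => hQ a b (hab.mono (Set.compl_subset_compl.2 hT))

theorem InvariantOn.isRare_of_fibers {T : Set I} (hQ : InvariantOn T Q)
    (h : ∀ a₀ ∈ Q, ∀ Q', InvariantOn T Q' → (∀ a ∈ Q', Set.EqOn a₀ a Tᶜ) → IsRare Q' P η) :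
    IsRare Q P η := by
  classical
  refine IsRare.of_fibers (Set.domRestrict Tᶜ) fun a₀ ha₀ => ?_
  refine h a₀ ha₀ _ (fun a b hab ha => ?_) fun a ha =>
    (Set.domRestrict_eq_domRestrict_iff.1 (Finset.mem_filter.1 ha).2).symm
  obtain ⟨haQ, haa₀⟩ := Finset.mem_filter.1 ha
  exact Finset.mem_filter.2
    ⟨hQ a b hab haQ, (Set.domRestrict_eq_domRestrict_iff.2 hab).symm.trans haa₀⟩

theorem InvariantOn.isRare_not_eqOn {T : Finset I} (hQ : InvariantOn (T : Set I) Q)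
    (p : I → Bool) : IsRare Q (fun a => ¬ Set.EqOn a p T) (1 - ((2 : ℝ) ^ #T)⁻¹) := by
  classical
  have hcard : #Q ≤ 2 ^ #T * #{a ∈ Q | Set.EqOn a p T} := by
    refine Finset.card_le_mul_card_image_of_maps_to (f := fun a => T.piecewise p a) ?_ _ ?_
    · exact fun a ha => Finset.mem_filter.2
        ⟨hQ a _ (fun i hi => (T.piecewise_eq_of_notMem p a hi).symm) ha,
          fun i hi => T.piecewise_eq_of_mem p a hi⟩
    · intro b _
      rw [← Finset.card_powerset]
      refine Finset.card_le_card_of_injOn (fun a => {i ∈ T | a i = true})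
        (fun a _ => Finset.mem_coe.2 (Finset.mem_powerset.2 (Finset.filter_subset _ _))) ?_
      intro a ha a' ha' heq
      have hpiecewise := (Finset.mem_filter.1 ha).2.trans (Finset.mem_filter.1 ha').2.symm
      funext i
      by_cases hi : i ∈ T
      · exact Bool.eq_iff_iff.2 (by simpa [hi] using Finset.ext_iff.1 heq i)
      · simpa [hi] using congrFun hpiecewise i
  have hsplit := Finset.card_filter_add_card_filter_not (s := Q) fun a => Set.EqOn a p T
  rw [isRare_iff, sub_mul, one_mul, le_sub_comm, inv_mul_le_iff₀ (by positivity)]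
  rw [← Nat.cast_inj (R := ℝ), Nat.cast_add, ← eq_sub_iff_add_eq] at hsplit
  rw [← hsplit]
  exact_mod_cast hcard

theorem isRare_forall_not_eqOn {J : Finset κ} {T : κ → Finset I} {p : κ → I → Bool} {s : ℕ}
    (hQ : ∀ j ∈ J, InvariantOn (T j : Set I) Q) (hdisj : (J : Set κ).PairwiseDisjoint T)
    (hs : ∀ j ∈ J, #(T j) ≤ s) :
    IsRare Q (fun a => ∀ j ∈ J, ¬ Set.EqOn a (p j) (T j)) ((1 - ((2 : ℝ) ^ s)⁻¹) ^ #J) := by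
  classical
  induction J using Finset.induction_on with
  | empty => exact isRare_of_one_le (by simp)
  | insert j J hj ih =>
    simp only [Finset.forall_mem_insert] at hQ hs ⊢
    rw [Finset.coe_insert, Set.pairwiseDisjoint_insert_of_notMem (by simpa using hj)] at hdisj
    have hinv : InvariantOn (T j : Set I) {a ∈ Q | ∀ j ∈ J, ¬ Set.EqOn a (p j) (T j)} := by
      intro a b hab ha
      obtain ⟨haQ, hne⟩ := Finset.mem_filter.1 ha
      refine Finset.mem_filter.2 ⟨hQ.1 a b hab haQ, fun j' hj' heq => hne j' hj' fun i hi => ?_⟩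
      rw [hab (Finset.disjoint_right.1 (hdisj.2 j' hj') hi), heq hi]
    have hfirst : IsRare {a ∈ Q | ∀ j ∈ J, ¬ Set.EqOn a (p j) (T j)}
        (fun a => ¬ Set.EqOn a (p j) (T j)) (1 - (2 ^ s)⁻¹) := by
      refine (hinv.isRare_not_eqOn (p j)).mono (fun _ _ h => h) ?_
      gcongr
      · norm_num
      · exact hs.1
    rw [Finset.card_insert_of_notMem hj, pow_succ]
    refine ((ih hQ.2 hdisj.1 hs.2).and hfirst ?_).mono (fun _ _ h => ⟨h.2, h.1⟩) le_rfl
    exact sub_nonneg.2 (inv_le_one_of_one_le₀ (one_le_pow₀ one_le_two))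

end Tables

section ConflictGraph

variable {V : Type*} {F : Digraph V} {u v w : V}

theorem Connected.symm (h : Connected F u v) : Connected F v u :=
  ⟨h.1.symm, h.2.symm⟩

/-- The conflict graph of a digraph: two distinct nodes are in conflict when they are connected or
have a common neighbour. Nodes without conflict can be embedded independently of each other. -/
def conflictGraph (F : Digraph V) : SimpleGraph V where
  Adj u v := u ≠ v ∧ (Connected F u v ∨ ∃ w, Connected F u w ∧ Connected F v w)
  symm := ⟨fun _ _ h => ⟨h.1.symm, h.2.imp Connected.symm fun ⟨w, hu, hv⟩ => ⟨w, hv, hu⟩⟩⟩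
  loopless := ⟨fun _ h => h.1 rfl⟩

variable [Fintype V] {d : ℕ}

open Classical in
/-- The nodes connected to `u`. -/
noncomputable def nbrs (F : Digraph V) (u : V) : Finset V := {w | Connected F u w}

theorem mem_nbrs : w ∈ nbrs F u ↔ Connected F u w := by
  simp [nbrs]

theorem card_nbrs (F : Digraph V) (u : V) : #(nbrs F u) = nodeDegree F u := by
  rw [nodeDegree, ← Set.ncard_coe_finset]
  congr 1
  ext w
  simp [mem_nbrs]

theorem degreeIn_conflictGraph_le (hdeg : ∀ u, nodeDegree F u ≤ d) (u : V) :
    degreeIn (conflictGraph F) Finset.univ u ≤ d ^ 2 := by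
  classical
  have hsub : ({v ∈ Finset.univ | (conflictGraph F).Adj u v} : Finset V) ⊆
      (nbrs F u).biUnion fun w => insert w ((nbrs F w).erase u) := by
    intro v hv
    obtain ⟨hne, huv | ⟨w, huw, hvw⟩⟩ := (Finset.mem_filter.1 hv).2
    · exact Finset.mem_biUnion.2 ⟨v, mem_nbrs.2 huv, Finset.mem_insert_self ..⟩
    · exact Finset.mem_biUnion.2 ⟨w, mem_nbrs.2 huw, Finset.mem_insert_of_mem
        (Finset.mem_erase.2 ⟨hne.symm, mem_nbrs.2 hvw.symm⟩)⟩
  have hcard : ∀ w ∈ nbrs F u, #(insert w ((nbrs F w).erase u)) ≤ d := by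
    intro w hw
    have hu := Finset.card_erase_add_one (mem_nbrs.2 (mem_nbrs.1 hw).symm)
    have hd := (card_nbrs F w).trans_le (hdeg w)
    exact (Finset.card_insert_le _ _).trans (hu.trans_le hd)
  calc degreeIn (conflictGraph F) Finset.univ u
      = #{v ∈ Finset.univ | (conflictGraph F).Adj u v} := by unfold degreeIn; congr
    _ ≤ #(nbrs F u) * d :=
        (Finset.card_le_card hsub).trans (Finset.card_biUnion_le_card_mul _ _ _ hcard)
    _ ≤ d ^ 2 := by rw [sq]; exact Nat.mul_le_mul_right _ ((card_nbrs F u).trans_le (hdeg u))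

end ConflictGraph

section Levels

variable {V : Type*} {F : Digraph V} {S : Set V} {lev : V → ℕ} {i d : ℕ} {g : Equiv.Perm V}

/-- A partition of the nodes of `F` into levels, to be embedded one after the other: level `0` is
`S`, and the other levels are conflict-free and uniform in loops. -/
structure IsLevelling (F : Digraph V) (S : Set V) (lev : V → ℕ) : Prop where
  eq_zero_iff : ∀ v, lev v = 0 ↔ v ∈ S
  loop_iff : ∀ u v, lev u = lev v → lev u ≠ 0 → (F.Adj u u ↔ F.Adj v v)
  not_adj : ∀ u v, lev u = lev v → lev u ≠ 0 → ¬ (conflictGraph F).Adj u v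

theorem IsLevelling.not_connected (hl : IsLevelling F S lev) {u v : V} (huv : lev u = lev v)
    (hu : lev u ≠ 0) : ¬ Connected F u v :=
  fun h => hl.not_adj u v huv hu ⟨h.1, .inl h⟩

theorem IsLevelling.eq_of_connected (hl : IsLevelling F S lev) {u v w : V} (huv : lev u = lev v)
    (hu : lev u ≠ 0) (huw : Connected F u w) (hvw : Connected F v w) : u = v := by
  by_contra hne
  exact hl.not_adj u v huv hu ⟨hne, .inr ⟨w, huw, hvw⟩⟩

/-- `g` is a level-preserving permutation, fixing level `0`, that respects the edges of `F` between
distinct levels up to `i` as a map to the digraph with table `a`. -/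
structure EmbedsUpTo (F : Digraph V) (lev : V → ℕ) (i : ℕ) (a : V × V → Bool)
    (g : Equiv.Perm V) : Prop where
  lev_apply : ∀ v, lev (g v) = lev v
  apply_eq_self : ∀ v, lev v = 0 → g v = v
  edge_iff : ∀ u w, lev w < lev u → lev u ≤ i → Connected F u w →
    (a (g u, g w) = true ↔ F.Adj u w) ∧ (a (g w, g u) = true ↔ F.Adj w u)

/-- The pairs joining level `i` to a lower level: the edges exposed when level `i` is embedded. -/
def freshPairs (lev : V → ℕ) (i : ℕ) : Set (V × V) :=
  {e | (lev e.1 = i ∧ lev e.2 < i) ∨ (lev e.2 = i ∧ lev e.1 < i)}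

theorem EmbedsUpTo.congr {a b : V × V → Bool} (hg : EmbedsUpTo F lev i a g)
    (hab : Set.EqOn a b (freshPairs lev (i + 1))ᶜ) : EmbedsUpTo F lev i b g := by
  refine ⟨hg.lev_apply, hg.apply_eq_self, fun u w hwu hu hc => ?_⟩
  have h := hg.edge_iff u w hwu hu hc
  rwa [hab (x := (g u, g w)), hab (x := (g w, g u))] at h
  all_goals
    simp only [freshPairs, Set.mem_compl_iff, Set.mem_ofPred_eq, hg.lev_apply]
    omega

/-- `v` is a possible image of the node `u` of level `i` in the digraph with table `a`, given the
images under `g` of the lower levels. -/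
def Fits (F : Digraph V) (lev : V → ℕ) (i : ℕ) (g : Equiv.Perm V) (a : V × V → Bool)
    (u v : V) : Prop :=
  ∀ w, lev w < i → Connected F u w →
    (a (v, g w) = true ↔ F.Adj u w) ∧ (a (g w, v) = true ↔ F.Adj w u)

theorem EmbedsUpTo.extend {a : V × V → Bool} (hg : EmbedsUpTo F lev i a g)
    (f : Equiv.Perm {v : V // lev v = i + 1})
    (hf : ∀ u : {v : V // lev v = i + 1}, Fits F lev (i + 1) g a u (f u)) :
    ∃ g', EmbedsUpTo F lev (i + 1) a g' := by
  let g' := Equiv.Perm.subtypeCongr (p := fun v => lev v = i + 1) f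
    (g.subtypePerm fun v => by rw [hg.lev_apply])
  have hlevel (v : V) (hv : lev v = i + 1) : g' v = f ⟨v, hv⟩ :=
    Equiv.Perm.subtypeCongr.left_apply (p := fun v => lev v = i + 1) _ _ hv
  have hother (v : V) (hv : lev v ≠ i + 1) : g' v = g v :=
    Equiv.Perm.subtypeCongr.right_apply (p := fun v => lev v = i + 1) _ _ hv
  refine ⟨g', fun v => ?_, fun v hv => ?_, fun u w hwu hu hc => ?_⟩
  · by_cases hv : lev v = i + 1
    · rw [hlevel v hv, (f _).2, hv]
    · rw [hother v hv, hg.lev_apply]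
  · rw [hother v (by omega), hg.apply_eq_self v hv]
  · rw [hother w (by omega)]
    by_cases hu' : lev u = i + 1
    · rw [hlevel u hu']
      exact hf ⟨u, hu'⟩ w (by omega) hc
    · rw [hother u hu']
      exact hg.edge_iff u w hwu (by omega) hc

variable [Fintype V]

open Classical in
/-- The pairs whose edges decide whether `v` fits `u`. -/
noncomputable def fitPairs (F : Digraph V) (lev : V → ℕ) (i : ℕ) (g : Equiv.Perm V) (u v : V) :
    Finset (V × V) :=
  {w ∈ nbrs F u | lev w < i}.image (fun w => (v, g w)) ∪
    {w ∈ nbrs F u | lev w < i}.image (fun w => (g w, v))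

theorem mem_fitPairs {u v : V} {e : V × V} : e ∈ fitPairs F lev i g u v ↔
    ∃ w, lev w < i ∧ Connected F u w ∧ ((v, g w) = e ∨ (g w, v) = e) := by
  simp only [fitPairs, Finset.mem_union, Finset.mem_image, Finset.mem_filter, mem_nbrs]
  grind

theorem card_fitPairs_le (hdeg : ∀ u, nodeDegree F u ≤ d) (u v : V) :
    #(fitPairs F lev i g u v) ≤ 2 * d := by
  classical
  have hlower : #{w ∈ nbrs F u | lev w < i} ≤ d :=
    (Finset.card_filter_le _ _).trans ((card_nbrs F u).trans_le (hdeg u))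
  rw [two_mul]
  unfold fitPairs
  exact (Finset.card_union_le _ _).trans (add_le_add
    (Finset.card_image_le.trans hlower) (Finset.card_image_le.trans hlower))

theorem fitPairs_subset_freshPairs (hg : ∀ v, lev (g v) = lev v) {u v : V} (hv : lev v = i) :
    ↑(fitPairs F lev i g u v) ⊆ freshPairs lev i := by
  intro e he
  obtain ⟨w, hw, -, rfl | rfl⟩ := mem_fitPairs.1 he
  · exact .inl ⟨hv, (hg w).trans_lt hw⟩
  · exact .inr ⟨hv, (hg w).trans_lt hw⟩

open Classical in
/-- The table of `F`, transported along `g` except that `v` plays the role of `u`. -/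
noncomputable def fitPattern (F : Digraph V) (g : Equiv.Perm V) (u v : V) : V × V → Bool :=
  fun e => decide (F.Adj (Function.update g.symm v u e.1) (Function.update g.symm v u e.2))

theorem fits_of_eqOn_fitPairs (hg : ∀ v, lev (g v) = lev v) {u v : V} (hv : lev v = i)
    {a : V × V → Bool} (ha : Set.EqOn a (fitPattern F g u v) (fitPairs F lev i g u v)) :
    Fits F lev i g a u v := by
  intro w hw hc
  have hne : g w ≠ v := fun h => (hg w ▸ hw).ne (h ▸ hv)
  rw [ha (mem_fitPairs.2 ⟨w, hw, hc, .inl rfl⟩), ha (mem_fitPairs.2 ⟨w, hw, hc, .inr rfl⟩)]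
  simp [fitPattern, hne]

theorem IsLevelling.disjoint_fitPairs (hl : IsLevelling F S lev) (hi : i ≠ 0)
    (hg : ∀ v, lev (g v) = lev v) {u v u' v' : V} (hu : lev u = i) (hv : lev v = i)
    (hu' : lev u' = i) (hne : (u, v) ≠ (u', v')) :
    Disjoint (fitPairs F lev i g u v) (fitPairs F lev i g u' v') := by
  refine Finset.disjoint_left.2 fun e he he' => hne ?_
  have hcommon (w : V) (h : Connected F u w) (h' : Connected F u' w) : u = u' :=
    hl.eq_of_connected (hu.trans hu'.symm) (hu ▸ hi) h h'
  have hlower {w x : V} (hw : lev w < i) (hx : lev x = i) : g w ≠ x :=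
    fun h => (hg w ▸ hw).ne (h ▸ hx)
  obtain ⟨w, -, hc, rfl | rfl⟩ := mem_fitPairs.1 he <;>
    obtain ⟨w', hw', hc', h | h⟩ := mem_fitPairs.1 he' <;>
    obtain ⟨h₁, h₂⟩ := Prod.mk.inj h
  · exact Prod.ext (hcommon w hc (g.injective h₂ ▸ hc')) h₁.symm
  · exact absurd h₁ (hlower hw' hv)
  · exact absurd h₂ (hlower hw' hv)
  · exact Prod.ext (hcommon w hc (g.injective h₁ ▸ hc')) h₂.symm

theorem IsLevelling.isSpread_fits (hl : IsLevelling F S lev) (hdeg : ∀ u, nodeDegree F u ≤ d)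
    (hi : i ≠ 0) (hg : ∀ v, lev (g v) = lev v) {Q : Finset (V × V → Bool)}
    (hQ : InvariantOn (freshPairs lev i) Q) :
    IsSpread Q (fun a (u v : {v : V // lev v = i}) => Fits F lev i g a u v) ((4 : ℝ) ^ d)⁻¹ := by
  classical
  intro X Y
  have havoid := isRare_forall_not_eqOn (Q := Q) (J := X ×ˢ Y)
    (T := fun j => fitPairs F lev i g j.1 j.2) (p := fun j => fitPattern F g j.1 j.2)
    (fun j _ => hQ.mono (fitPairs_subset_freshPairs hg j.2.2))
    (fun j _ j' _ hne => hl.disjoint_fitPairs hi hg j.1.2 j.2.2 j'.1.2 fun h =>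
      hne (Prod.ext (Subtype.ext (Prod.mk.inj h).1) (Subtype.ext (Prod.mk.inj h).2)))
    (fun j _ => card_fitPairs_le hdeg j.1 j.2)
  rw [pow_mul, show (2 : ℝ) ^ 2 = 4 by norm_num, Finset.card_product] at havoid
  refine havoid.mono (fun a _ hun j hj heq => ?_) le_rfl
  obtain ⟨hX, hY⟩ := Finset.mem_product.1 hj
  exact hun j.1 hX j.2 hY (fits_of_eqOn_fitPairs hg j.2.2 heq)

theorem IsLevelling.isRare_not_embedsUpTo_succ (hl : IsLevelling F S lev)
    (hdeg : ∀ u, nodeDegree F u ≤ d) {Q : Finset (V × V → Bool)}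
    (hQ : InvariantOn (freshPairs lev (i + 1)) Q) :
    IsRare Q (fun a => (∃ g, EmbedsUpTo F lev i a g) ∧ ¬ ∃ g, EmbedsUpTo F lev (i + 1) a g)
      (4 * hallFailure (Fintype.card {v : V // lev v = i + 1}) ((4 : ℝ) ^ d)⁻¹) := by
  refine hQ.isRare_of_fibers fun a₀ _ Q' hQ' hfresh => ?_
  by_cases hembeds : ∃ g, EmbedsUpTo F lev i a₀ g
  · obtain ⟨g, hg⟩ := hembeds
    have hmatching := (hl.isSpread_fits hdeg i.succ_ne_zero hg.lev_apply hQ').isRare_not_hasMatching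
      (by positivity) (inv_le_one_of_one_le₀ (one_le_pow₀ (by norm_num))) rfl
    refine hmatching.mono (fun a ha hno hmatch => hno.2 ?_) le_rfl
    obtain ⟨f, hf, hfit⟩ := hmatch
    exact (hg.congr (hfresh a ha)).extend
      (Equiv.ofBijective f (Finite.injective_iff_bijective.1 hf)) hfit
  · refine isRare_of_forall_not (mul_nonneg zero_le_four (hallFailure_nonneg _ _)) ?_
    rintro a ha ⟨⟨g, hg⟩, -⟩
    exact hembeds ⟨g, hg.congr (hfresh a ha).symm⟩

theorem IsLevelling.isRare_not_embedsUpTo (hl : IsLevelling F S lev)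
    (hdeg : ∀ u, nodeDegree F u ≤ d) {δ : ℝ} (R : ℕ)
    (hδ : ∀ i < R, 4 * hallFailure (Fintype.card {v : V // lev v = i + 1}) ((4 : ℝ) ^ d)⁻¹ ≤ δ)
    {Q : Finset (V × V → Bool)} (hQ : ∀ i < R, InvariantOn (freshPairs lev (i + 1)) Q) :
    IsRare Q (fun a => ¬ ∃ g, EmbedsUpTo F lev R a g) (R * δ) := by
  induction R with
  | zero =>
    refine isRare_of_forall_not (by simp) fun a _ hno => hno ⟨Equiv.refl V, ?_⟩
    exact ⟨fun _ => rfl, fun _ _ => rfl, fun u w hwu hu => by omega⟩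
  | succ R ih =>
    have hbefore := ih (fun i hi => hδ i (by omega)) fun i hi => hQ i (by omega)
    have hstep := hl.isRare_not_embedsUpTo_succ hdeg (hQ R R.lt_succ_self)
    refine (hbefore.or hstep).mono (fun a _ hno => ?_) ?_
    · by_cases h : ∃ g, EmbedsUpTo F lev R a g
      · exact .inr ⟨h, hno⟩
      · exact .inl h
    · push_cast
      linarith [hδ R R.lt_succ_self]

end Levels

section LevelExistence

variable {V : Type*} {F : Digraph V} {d : ℕ}

theorem exists_conflictFree_coloring [Finite V] (hdeg : ∀ u, nodeDegree F u ≤ d) (A : Set V) :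
    ∃ c : V → Fin (d ^ 2 + 1),
      (∀ u ∈ A, ∀ v ∈ A, c u = c v → ¬ (conflictGraph F).Adj u v) ∧
      ∀ i, A.ncard / (d ^ 2 + 1) ≤ {v | v ∈ A ∧ c v = i}.ncard := by
  classical
  cases nonempty_fintype V
  obtain ⟨C, hC⟩ := exists_coloring_div_le_card_classOf (ι := Fin (d ^ 2 + 1))
    (G := (conflictGraph F).induce A) fun x => by
      rw [Fintype.card_fin, Nat.lt_succ_iff]
      refine le_trans ?_ (degreeIn_conflictGraph_le hdeg x)
      refine Finset.card_le_card_of_injOn Subtype.val (fun y hy => ?_) Subtype.val_injective.injOn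
      exact Finset.mem_coe.2 (Finset.mem_filter.2
        ⟨Finset.mem_univ _, (Finset.mem_filter.1 (Finset.mem_coe.1 hy)).2⟩)
  have hextend : ∀ v (hv : v ∈ A), (if hv : v ∈ A then C ⟨v, hv⟩ else 0) = C ⟨v, hv⟩ :=
    fun v hv => dif_pos hv
  refine ⟨fun v => if hv : v ∈ A then C ⟨v, hv⟩ else 0, fun u hu v hv huv hadj => ?_, fun i => ?_⟩
  · dsimp only at huv
    rw [hextend u hu, hextend v hv] at huv
    exact C.valid (v := ⟨u, hu⟩) (w := ⟨v, hv⟩) hadj huv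
  · have hclass : {v | v ∈ A ∧ (if hv : v ∈ A then C ⟨v, hv⟩ else 0) = i} =
        Subtype.val '' (classOf C i : Set A) := by
      ext v
      constructor
      · rintro ⟨hv, hvi⟩
        exact ⟨⟨v, hv⟩, mem_classOf.2 (hextend v hv ▸ hvi), rfl⟩
      · rintro ⟨⟨v, hv⟩, hvi, rfl⟩
        exact ⟨hv, (hextend v hv).trans (mem_classOf.1 hvi)⟩
    rw [hclass, Set.ncard_image_of_injective _ Subtype.val_injective, Set.ncard_coe_finset,
      ← Nat.card_coe_set_eq, Nat.card_eq_fintype_card]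
    simpa only [Fintype.card_fin] using hC i

/-- The nodes outside `S` that have a loop if and only if `v` has one. -/
def loopMates (F : Digraph V) (S : Set V) (v : V) : Set V :=
  {w | w ∉ S ∧ (F.Adj w w ↔ F.Adj v v)}

theorem loopMates_eq_looped_or_unlooped (F : Digraph V) (S : Set V) (v : V) :
    loopMates F S v = looped F \ S ∨ loopMates F S v = unlooped F \ S := by
  by_cases hv : F.Adj v v
  · exact .inl (Set.ext fun w => by simp [loopMates, looped, hv, and_comm])
  · exact .inr (Set.ext fun w => by simp [loopMates, unlooped, hv, and_comm])

theorem exists_conflictFree_loop_coloring [Finite V] (F : Digraph V) (S : Set V)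
    (hdeg : ∀ u, nodeDegree F u ≤ d) :
    ∃ c : V → Bool × Fin (d ^ 2 + 1),
      (∀ u v, c u = c v → (F.Adj u u ↔ F.Adj v v)) ∧
      (∀ u ∉ S, ∀ v ∉ S, c u = c v → ¬ (conflictGraph F).Adj u v) ∧
      ∀ v, (loopMates F S v).ncard / (d ^ 2 + 1) ≤ {w | w ∉ S ∧ c w = c v}.ncard := by
  classical
  let b : V → Bool := fun v => decide (F.Adj v v)
  have hb (u v : V) : b u = b v ↔ (F.Adj u u ↔ F.Adj v v) := decide_eq_decide
  choose col hcol hsize using fun β => exists_conflictFree_coloring hdeg {v | v ∉ S ∧ b v = β}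
  refine ⟨fun v => (b v, col (b v) v), fun u v huv => (hb u v).1 (Prod.mk.inj huv).1,
    fun u hu v hv huv => ?_, fun v => ?_⟩
  · obtain ⟨hbuv, hcuv⟩ := Prod.mk.inj huv
    rw [hbuv] at hcuv
    exact hcol (b v) u ⟨hu, hbuv⟩ v ⟨hv, rfl⟩ hcuv
  · have hmates : loopMates F S v = {w | w ∉ S ∧ b w = b v} :=
      Set.ext fun w => and_congr_right fun _ => (hb w v).symm
    rw [hmates]
    refine (hsize (b v) (col (b v) v)).trans (Set.ncard_le_ncard ?_ (Set.toFinite _))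
    rintro w ⟨⟨hw, hbw⟩, hcw⟩
    exact ⟨hw, Prod.ext hbw ((congrArg (col · w) hbw).trans hcw)⟩

theorem exists_isLevelling [Finite V] (F : Digraph V) (S : Set V) (hdeg : ∀ u, nodeDegree F u ≤ d) :
    ∃ lev : V → ℕ, IsLevelling F S lev ∧ (∀ v, lev v ≤ 2 * (d ^ 2 + 1)) ∧
      ∀ v ∉ S, (loopMates F S v).ncard / (d ^ 2 + 1) ≤ {w | lev w = lev v}.ncard := by
  classical
  obtain ⟨c, hloop, hconflict, hsize⟩ := exists_conflictFree_loop_coloring F S hdeg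
  let e : Bool × Fin (d ^ 2 + 1) ≃ Fin (2 * (d ^ 2 + 1)) := Fintype.equivFinOfCardEq (by simp)
  let lev : V → ℕ := fun v => if v ∈ S then 0 else e (c v) + 1
  have hlev {v : V} (hv : v ∉ S) : lev v = e (c v) + 1 := if_neg hv
  have hzero (v : V) : lev v = 0 ↔ v ∈ S := by simp [lev]
  have hcolor {u v : V} (huv : lev u = lev v) (hu : lev u ≠ 0) : u ∉ S ∧ v ∉ S ∧ c u = c v := by
    have hv : v ∉ S := fun hv => hu (huv.trans ((hzero v).2 hv))
    have hu : u ∉ S := fun h => hu ((hzero u).2 h)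
    rw [hlev hu, hlev hv, Nat.add_right_cancel_iff, Fin.val_inj] at huv
    exact ⟨hu, hv, e.injective huv⟩
  refine ⟨lev, ⟨hzero, fun u v huv hu => hloop u v (hcolor huv hu).2.2, fun u v huv hu => ?_⟩,
    fun v => ?_, fun v hv => ?_⟩
  · obtain ⟨hu, hv, hc⟩ := hcolor huv hu
    exact hconflict u hu v hv hc
  · by_cases hv : v ∈ S
    · exact ((hzero v).2 hv).trans_le (Nat.zero_le _)
    · exact (hlev hv).trans_le (e (c v)).isLt
  · refine (hsize v).trans (Set.ncard_le_ncard ?_ (Set.toFinite _))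
    rintro w ⟨hw, hcw⟩
    exact (hlev hw).trans (hcw ▸ (hlev hv).symm)

end LevelExistence

section Agreement

variable {V : Type*} {F : Digraph V} {S : Set V} {a : V × V → Bool}

/-- The table `a` has the loops of `F` and agrees with `F` on `S`. Such tables are easier to handle
than those of compatible digraphs, since their entries off the loops and `S` are independent. -/
def AgreesWith (F : Digraph V) (S : Set V) (a : V × V → Bool) : Prop :=
  (∀ v, a (v, v) = true ↔ F.Adj v v) ∧ SameInducedOn S F (ofTable a)

/-- There is a di-embedding of `F` into the digraph with table `a` that fixes `S`: the event whose
probability is bounded below. -/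
def EmbedsFixing (F : Digraph V) (S : Set V) (a : V × V → Bool) : Prop :=
  ∃ g : V → V, IsDiEmbedding F (ofTable a) g ∧ ∀ u ∈ S, g u = u

theorem EmbedsUpTo.embedsFixing {lev : V → ℕ} {R : ℕ} {g : Equiv.Perm V}
    (hg : EmbedsUpTo F lev R a g) (hl : IsLevelling F S lev) (hR : ∀ v, lev v ≤ R)
    (ha : AgreesWith F S a) : EmbedsFixing F S a := by
  have hloop (x : V) : F.Adj x x ↔ a (g x, g x) = true := by
    rw [ha.1]
    by_cases hx : lev x = 0
    · rw [hg.apply_eq_self x hx]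
    · exact hl.loop_iff x (g x) (hg.lev_apply x).symm hx
  have hedge (x y : V) (hxy : Connected F x y) : F.Adj x y ↔ a (g x, g y) = true := by
    rcases lt_trichotomy (lev x) (lev y) with hlt | heq | hgt
    · exact (hg.edge_iff y x hlt (hR y) hxy.symm).2.symm
    · have hx : lev x = 0 := by
        by_contra hx
        exact hl.not_connected heq hx hxy
      have hy : lev y = 0 := heq ▸ hx
      rw [hg.apply_eq_self x hx, hg.apply_eq_self y hy]
      exact ha.2 x ((hl.eq_zero_iff x).1 hx) y ((hl.eq_zero_iff y).1 hy)
    · exact (hg.edge_iff x y hgt (hR x) hxy).1.symm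
  refine ⟨g, ⟨g.injective, ?_⟩, fun u hu => hg.apply_eq_self u ((hl.eq_zero_iff u).2 hu)⟩
  rintro u v huv x (rfl | rfl) y (rfl | rfl)
  · exact hloop _
  · exact hedge _ _ huv
  · exact hedge _ _ huv.symm
  · exact hloop _

theorem IsLevelling.agreesWith_congr {lev : V → ℕ} (hl : IsLevelling F S lev) {i : ℕ}
    {b : V × V → Bool} (hab : Set.EqOn a b (freshPairs lev (i + 1))ᶜ) (ha : AgreesWith F S a) :
    AgreesWith F S b := by
  have hkept {u v : V} (huv : lev u = lev v) : a (u, v) = b (u, v) := by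
    refine hab ?_
    simp only [freshPairs, Set.mem_compl_iff, Set.mem_ofPred_eq]
    omega
  refine ⟨fun v => hkept (rfl : lev v = lev v) ▸ ha.1 v, fun u hu v hv => ?_⟩
  have huv := ha.2 u hu v hv
  simp only [ofTable] at huv ⊢
  rwa [hkept (((hl.eq_zero_iff u).2 hu).trans ((hl.eq_zero_iff v).2 hv).symm)] at huv

open Classical in
theorem isRare_agreesWith_not_embedsFixing [Fintype V] {d : ℕ} {ε : ℝ} (hε : 0 < ε)
    (hdeg : ∀ u, nodeDegree F u ≤ d)
    (hsize : ∀ v ∉ S, ∀ k, (loopMates F S v).ncard / (d ^ 2 + 1) ≤ k →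
      2 * ((d : ℝ) ^ 2 + 1) * (4 * hallFailure k ((4 : ℝ) ^ d)⁻¹) ≤ ε) :
    IsRare {a : V × V → Bool | AgreesWith F S a} (fun a => ¬ EmbedsFixing F S a) ε := by
  obtain ⟨lev, hl, hR, hcard⟩ := exists_isLevelling F S hdeg
  have hpos : 0 < 2 * ((d : ℝ) ^ 2 + 1) := by positivity
  have hfail (i : ℕ) : 4 * hallFailure (Fintype.card {v : V // lev v = i + 1}) ((4 : ℝ) ^ d)⁻¹ ≤
      ε / (2 * ((d : ℝ) ^ 2 + 1)) := by
    rcases isEmpty_or_nonempty {v : V // lev v = i + 1} with hempty | ⟨v, hv⟩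
    · rw [Fintype.card_eq_zero, hallFailure]
      simp only [CharP.cast_eq_zero, mul_zero, zero_mul, ne_eq, OfNat.ofNat_ne_zero,
        not_false_eq_true, zero_pow, add_zero]
      positivity
    · rw [le_div_iff₀' hpos]
      refine hsize v (fun hvS => ?_) _ ((hcard v fun hvS => ?_).trans_eq ?_)
      · exact absurd ((hl.eq_zero_iff v).2 hvS) (by omega)
      · exact absurd ((hl.eq_zero_iff v).2 hvS) (by omega)
      · rw [hv, ← Nat.card_coe_set_eq, ← Nat.card_eq_fintype_card]
        rfl
  have hrare := hl.isRare_not_embedsUpTo hdeg (2 * (d ^ 2 + 1)) (fun i _ => hfail i)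
    (Q := {a | AgreesWith F S a}) fun i _ a b hab ha =>
      Finset.mem_filter.2 ⟨Finset.mem_univ _, hl.agreesWith_congr hab (Finset.mem_filter.1 ha).2⟩
  refine hrare.mono (fun a ha hno hg => hno ?_) ?_
  · obtain ⟨g, hg⟩ := hg
    exact hg.embedsFixing hl hR (Finset.mem_filter.1 ha).2
  · push_cast
    rw [mul_div_cancel₀ _ hpos.ne']

end Agreement

section Compatible

variable {V : Type*} {F : Digraph V} {S : Set V}

theorem exists_perm_apply_mem_iff [Finite V] {A B S : Set V} (hcard : A.ncard = B.ncard)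
    (hS : ∀ v ∈ S, v ∈ A ↔ v ∈ B) :
    ∃ π : Equiv.Perm V, (∀ v ∈ S, π v = v) ∧ ∀ v, π v ∈ B ↔ v ∈ A := by
  classical
  have hdiff : (A \ S).ncard = (B \ S).ncard := by
    have hinter : A ∩ S = B ∩ S := Set.ext fun v => and_congr_left (hS v)
    have hA := Set.ncard_inter_add_ncard_sdiff_eq_ncard A S (Set.toFinite _)
    have hB := Set.ncard_inter_add_ncard_sdiff_eq_ncard B S (Set.toFinite _)
    rw [hinter] at hA
    omega
  have hsubtype (A : Set V) : Nat.card {x : {v // v ∉ S} // (x : V) ∈ A} = (A \ S).ncard := by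
    rw [← Nat.card_coe_set_eq]
    exact Nat.card_congr ((Equiv.subtypeSubtypeEquivSubtypeInter (· ∉ S) (· ∈ A)).trans
      (Equiv.subtypeEquivRight fun _ => and_comm))
  obtain ⟨e⟩ := Finite.card_eq.1 ((hsubtype A).trans (hdiff.trans (hsubtype B).symm))
  have hfix (v : V) (hv : v ∈ S) : Equiv.Perm.ofSubtype e.extendSubtype v = v :=
    Equiv.Perm.ofSubtype_apply_of_not_mem _ (not_not.2 hv)
  refine ⟨Equiv.Perm.ofSubtype e.extendSubtype, hfix, fun v => ?_⟩
  by_cases hv : v ∈ S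
  · rw [hfix v hv, hS v hv]
  · rw [Equiv.Perm.ofSubtype_apply_of_mem (p := (· ∉ S)) _ hv]
    by_cases hvA : v ∈ A
    · exact iff_of_true (e.extendSubtype_mem ⟨v, hv⟩ hvA) hvA
    · exact iff_of_false (e.extendSubtype_not_mem ⟨v, hv⟩ hvA) hvA

/-- Relabelling the nodes of the digraph with a given table by a permutation. -/
def relabel (π : Equiv.Perm V) : (V × V → Bool) ≃ (V × V → Bool) :=
  (π.prodCongr π).symm.arrowCongr (Equiv.refl Bool)

theorem relabel_apply (π : Equiv.Perm V) (a : V × V → Bool) (u v : V) :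
    relabel π a (u, v) = a (π u, π v) := rfl

theorem EmbedsFixing.of_relabel {π : Equiv.Perm V} (hπ : ∀ v ∈ S, π v = v) {a : V × V → Bool}
    (h : EmbedsFixing F S (relabel π a)) : EmbedsFixing F S a := by
  obtain ⟨g, hg, hS⟩ := h
  exact ⟨fun v => π (g v), ⟨π.injective.comp hg.injective, hg.iso⟩, fun u hu =>
    (congrArg π (hS u hu)).trans (hπ u hu)⟩

theorem agreesWith_relabel_iff {π : Equiv.Perm V} (hπ : ∀ v ∈ S, π v = v) {a b : V × V → Bool}
    (hb : ∀ v, b (π v, π v) = true ↔ F.Adj v v) :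
    AgreesWith F S (relabel π a) ↔
      SameInducedOn S F (ofTable a) ∧ ∀ v, a (v, v) = b (v, v) := by
  rw [AgreesWith, and_comm]
  refine and_congr ?_ ?_
  · refine forall₂_congr fun u hu => forall₂_congr fun v hv => ?_
    simp only [ofTable, relabel_apply, hπ u hu, hπ v hv]
  · rw [π.surjective.forall (p := fun v => a (v, v) = b (v, v))]
    refine forall_congr' fun v => ?_
    rw [relabel_apply, ← hb v]
    exact Bool.eq_iff_iff.symm

theorem compatible_ofTable_congr {a b : V × V → Bool} (hab : ∀ v, a (v, v) = b (v, v)) :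
    Compatible F (ofTable a) ↔ Compatible F (ofTable b) := by
  simp only [Compatible, looped, unlooped, ofTable, hab]

/-- The event of the conditioning in `condLaw`, for the digraph with table `a`. -/
def Admissible (F : Digraph V) (S : Set V) (a : V × V → Bool) : Prop :=
  SameInducedOn S F (ofTable a) ∧ Compatible F (ofTable a)

open Classical in
theorem isRare_admissible_not_embedsFixing [Fintype V] {η : ℝ}
    (h : IsRare {a : V × V → Bool | AgreesWith F S a} (fun a => ¬ EmbedsFixing F S a) η) :
    IsRare {a : V × V → Bool | Admissible F S a} (fun a => ¬ EmbedsFixing F S a) η := by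
  refine IsRare.of_fibers (fun a v => a (v, v)) fun a₀ ha₀ => ?_
  obtain ⟨hsame, hcompatible⟩ : Admissible F S a₀ := by simpa using ha₀
  obtain ⟨π, hfix, hloop⟩ := exists_perm_apply_mem_iff hcompatible.1 fun v hv => hsame v hv v hv
  refine (h.comap_equiv (relabel π) fun a => ?_).mono
    (fun a _ hno hrelabel => hno (hrelabel.of_relabel hfix)) le_rfl
  simp only [Finset.mem_filter, Finset.mem_univ, true_and, funext_iff,
    agreesWith_relabel_iff hfix hloop]
  exact ⟨fun h => ⟨h.1.1, h.2⟩,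
    fun h => ⟨⟨h.1, (compatible_ofTable_congr h.2).2 hcompatible⟩, h.2⟩⟩

end Compatible

section Law

variable {V : Type*} [Fintype V]

theorem edgeLaw_real_singleton (a : V × V → Bool) :
    (edgeLaw V).real {a} = (2 ^ Fintype.card (V × V))⁻¹ := by
  simp [edgeLaw, measureReal_def, Measure.pi_singleton]

instance isProbabilityMeasure_edgeLaw : IsProbabilityMeasure (edgeLaw V) := by
  unfold edgeLaw
  infer_instance

theorem edgeLaw_real (s : Finset (V × V → Bool)) :
    (edgeLaw V).real s = #s * (2 ^ Fintype.card (V × V))⁻¹ := by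
  rw [← sum_measureReal_singleton]
  simp [edgeLaw_real_singleton]

theorem IsRare.one_sub_le_cond_edgeLaw_real {Q : Finset (V × V → Bool)}
    {P : (V × V → Bool) → Prop} {η : ℝ} (h : IsRare Q (fun a => ¬ P a) η) (hQ : Q.Nonempty) :
    1 - η ≤ ((edgeLaw V)[|(Q : Set (V × V → Bool))]).real {a | P a} := by
  classical
  have hinter : (Q : Set (V × V → Bool)) ∩ {a | P a} = ({a ∈ Q | P a} : Finset _) := by
    ext a
    simp
  have hsplit : (#{a ∈ Q | P a} : ℝ) + #{a ∈ Q | ¬ P a} = #Q := by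
    exact_mod_cast Finset.card_filter_add_card_filter_not (s := Q) P
  have hQpos : (0 : ℝ) < #Q := by exact_mod_cast hQ.card_pos
  rw [measureReal_def, cond_apply Q.finite_toSet.measurableSet, ENNReal.toReal_mul,
    ENNReal.toReal_inv, ← measureReal_def, ← measureReal_def, hinter, edgeLaw_real, edgeLaw_real,
    ← div_eq_inv_mul, mul_div_mul_right _ _ (by positivity), le_div_iff₀ hQpos]
  linarith [isRare_iff.1 h]

open Classical in
theorem one_sub_le_condLaw_real {F : Digraph V} {S : Set V} {P : (V × V → Bool) → Prop} {η : ℝ}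
    (h : IsRare {a : V × V → Bool | Admissible F S a} (fun a => ¬ P a) η) :
    1 - η ≤ (condLaw F S).real {a | P a} := by
  have hF : ofTable (fun e : V × V => decide (F.Adj e.1 e.2)) = F := by
    ext u v
    simp [ofTable]
  have hadmissible : Admissible F S fun e => decide (F.Adj e.1 e.2) := by
    rw [Admissible, hF]
    exact ⟨fun _ _ _ _ => Iff.rfl, rfl, rfl⟩
  have hevent : {a | SameInducedOn S F (ofTable a) ∧ Compatible F (ofTable a)} =
      (({a | Admissible F S a} : Finset (V × V → Bool)) : Set _) := by
    simp only [Finset.coe_filter, Finset.mem_univ, true_and]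
    rfl
  rw [condLaw, hevent]
  exact h.one_sub_le_cond_edgeLaw_real ⟨_, Finset.mem_filter.2 ⟨Finset.mem_univ _, hadmissible⟩⟩

end Law

section Asymptotics

theorem exists_forall_pow_mul_exp_le {ε : ℝ} (hε : 0 < ε) :
    ∃ L : ℝ, 1 ≤ L ∧ ∀ t, L ≤ t →
      320 * (t ^ 3 * Real.exp (-(1 / 10) * t)) + 48400 * (t ^ 4 * Real.exp (-(1 / 2) * t)) ≤ ε := by
  have hcubic := tendsto_rpow_mul_exp_neg_mul_atTop_nhds_zero 3 (1 / 10) (by norm_num)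
  have hquartic := tendsto_rpow_mul_exp_neg_mul_atTop_nhds_zero 4 (1 / 2) (by norm_num)
  have hsum := (hcubic.const_mul 320).add (hquartic.const_mul 48400)
  rw [mul_zero, mul_zero, add_zero] at hsum
  obtain ⟨L, hL⟩ := eventually_atTop.1 (hsum.eventually_le_const hε)
  refine ⟨max L 1, le_max_right _ _, fun t ht => ?_⟩
  exact_mod_cast hL t ((le_max_left _ _).trans ht)

theorem four_pow_le_exp {d : ℕ} {t : ℝ} (ht : 7 / 4 * d ≤ t) :
    (4 : ℝ) ^ d ≤ Real.exp (4 / 5 * t) := by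
  rw [← Real.log_le_iff_le_exp (by positivity), Real.log_pow, show (4 : ℝ) = 2 ^ 2 by norm_num,
    Real.log_pow]
  push_cast
  nlinarith [Real.log_two_lt_d9, d.cast_nonneg (α := ℝ)]

theorem hallFailure_le {d : ℕ} {t : ℝ} {k : ℕ} (hk : (k : ℝ) = t * 4 ^ d) (ht : 0 ≤ t)
    (hd : 7 / 4 * d ≤ t) :
    hallFailure k ((4 : ℝ) ^ d)⁻¹ ≤
      20 * (t * Real.exp (-(1 / 10) * t)) + 3025 * (t ^ 2 * Real.exp (-(1 / 2) * t)) := by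
  have hkt : (k : ℝ) * ((4 : ℝ) ^ d)⁻¹ = t := by rw [hk]; field_simp
  have hfirst : k * Real.exp (-(9 / 10 * t)) ≤ t * Real.exp (-(1 / 10) * t) :=
    calc k * Real.exp (-(9 / 10 * t)) = t * (4 ^ d * Real.exp (-(9 / 10 * t))) := by rw [hk]; ring
      _ ≤ t * (Real.exp (4 / 5 * t) * Real.exp (-(9 / 10 * t))) := by
          gcongr
          exact four_pow_le_exp hd
      _ = t * Real.exp (-(1 / 10) * t) := by rw [← Real.exp_add]; ring_nf
  rw [hallFailure, hkt, show -(t / 2) = -(1 / 2) * t by ring]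
  linarith

theorem exists_forall_levels_mul_hallFailure_le {ε : ℝ} (hε : 0 < ε) :
    ∃ L : ℝ, ∀ d k : ℕ, max L (7 / 4 * d) * 4 ^ d ≤ k →
      2 * ((d : ℝ) ^ 2 + 1) * (4 * hallFailure k ((4 : ℝ) ^ d)⁻¹) ≤ ε := by
  obtain ⟨L, hL1, hL⟩ := exists_forall_pow_mul_exp_le hε
  refine ⟨L, fun d k hk => ?_⟩
  obtain ⟨t, ht⟩ : ∃ t : ℝ, (k : ℝ) = t * 4 ^ d := ⟨k / 4 ^ d, by field_simp⟩
  obtain ⟨htL, htd⟩ := max_le_iff.1 (le_of_mul_le_mul_right (ht ▸ hk) (by positivity))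
  have ht1 : 1 ≤ t := hL1.trans htL
  have hlevels : 2 * ((d : ℝ) ^ 2 + 1) ≤ 4 * t ^ 2 := by
    nlinarith [d.cast_nonneg (α := ℝ)]
  calc 2 * ((d : ℝ) ^ 2 + 1) * (4 * hallFailure k ((4 : ℝ) ^ d)⁻¹)
      ≤ 4 * t ^ 2 * (4 * (20 * (t * Real.exp (-(1 / 10) * t)) +
          3025 * (t ^ 2 * Real.exp (-(1 / 2) * t)))) := by
        gcongr
        · exact mul_nonneg zero_le_four (hallFailure_nonneg _ _)
        · exact hallFailure_le ht (zero_le_one.trans ht1) htd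
    _ = 320 * (t ^ 3 * Real.exp (-(1 / 10) * t)) + 48400 * (t ^ 4 * Real.exp (-(1 / 2) * t)) := by
        ring
    _ ≤ ε := hL t htL

theorem exists_forall_le_div_of_lt (L : ℝ) :
    ∃ M : ℝ, ∀ d m : ℕ, 2 * (d : ℝ) ^ 3 * 4 ^ d + M < m →
      max L (7 / 4 * d) * 4 ^ d ≤ (m / (d ^ 2 + 1) : ℕ) := by
  obtain ⟨b, hb⟩ := exists_nat_ge (max L 6)
  obtain ⟨hbL, hb6⟩ := max_le_iff.1 hb
  refine ⟨(2 * b * 4 ^ b + 1) * (b ^ 2 + 1), fun d m hm => ?_⟩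
  by_contra! hlt
  have hupper : (m : ℝ) < (max L (7 / 4 * d) * 4 ^ d + 1) * (d ^ 2 + 1) := by
    have hdiv : m < (m / (d ^ 2 + 1) + 1) * (d ^ 2 + 1) :=
      Nat.lt_mul_of_div_lt (Nat.lt_succ_self _) (by positivity)
    calc (m : ℝ) < ((m / (d ^ 2 + 1) : ℕ) + 1) * (d ^ 2 + 1) := by exact_mod_cast hdiv
      _ ≤ _ := by gcongr
  refine hm.not_ge (hupper.le.trans ?_)
  rcases le_total d b with hdb | hbd
  · have hmax : max L (7 / 4 * d) ≤ 2 * b := by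
      have hdb' : (d : ℝ) ≤ b := by exact_mod_cast hdb
      exact max_le (by linarith) (by linarith)
    calc (max L (7 / 4 * d) * 4 ^ d + 1) * ((d : ℝ) ^ 2 + 1)
        ≤ (2 * b * 4 ^ b + 1) * ((b : ℝ) ^ 2 + 1) := by gcongr; norm_num
      _ ≤ _ := le_add_of_nonneg_left (by positivity)
  · have hbd' : (b : ℝ) ≤ d := by exact_mod_cast hbd
    have hd6 : (6 : ℝ) ≤ d := hb6.trans hbd'
    have h4 : (1 : ℝ) ≤ 4 ^ d := one_le_pow₀ (by norm_num)
    rw [max_eq_right (by linarith)]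
    calc (7 / 4 * (d : ℝ) * 4 ^ d + 1) * ((d : ℝ) ^ 2 + 1)
        ≤ (7 / 4 * (d : ℝ) * 4 ^ d + 4 ^ d) * ((d : ℝ) ^ 2 + 1) := by gcongr
      _ = (7 / 4 * (d : ℝ) + 1) * ((d : ℝ) ^ 2 + 1) * 4 ^ d := by ring
      _ ≤ 2 * (d : ℝ) ^ 3 * 4 ^ d := by
          refine mul_le_mul_of_nonneg_right ?_ (by positivity)
          nlinarith [mul_nonneg (sub_nonneg.2 hd6) (sq_nonneg (d : ℝ))]
      _ ≤ _ := le_add_of_nonneg_right (by positivity)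

theorem exists_forall_levels_mul_hallFailure_le_of_lt {ε : ℝ} (hε : 0 < ε) :
    ∃ M : ℝ, ∀ d m : ℕ, 2 * (d : ℝ) ^ 3 * 4 ^ d + M < m → ∀ k, m / (d ^ 2 + 1) ≤ k →
      2 * ((d : ℝ) ^ 2 + 1) * (4 * hallFailure k ((4 : ℝ) ^ d)⁻¹) ≤ ε := by
  obtain ⟨L, hL⟩ := exists_forall_levels_mul_hallFailure_le hε
  obtain ⟨M, hM⟩ := exists_forall_le_div_of_lt L
  exact ⟨M, fun d m hm k hk => hL d k ((hM d m hm).trans (by exact_mod_cast hk))⟩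

end Asymptotics

theorem nodeDegree_le_degree {V : Type*} [Fintype V] (F : Digraph V) (u : V) :
    nodeDegree F u ≤ degree F :=
  Finset.le_sup (f := nodeDegree F) (Finset.mem_univ u)

end DiEmbed

theorem lemma4 (ω : ℕ → ℝ) (hω : Filter.Tendsto ω Filter.atTop Filter.atTop)
    (ε : ℝ) (hε : 0 < ε) :
    ∃ N : ℕ, ∀ (V : Type*) [Fintype V] (F : Digraph V) (S : Set V) (n d : ℕ),
      n = Fintype.card V → N ≤ n → d = DiEmbed.degree F →
      2 * (d : ℝ) ^ 3 * 4 ^ d + ω n < (Sᶜ.ncard : ℝ) →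
      (DiEmbed.looped F \ S = ∅ ∨
        2 * (d : ℝ) ^ 3 * 4 ^ d + ω n < ((DiEmbed.looped F \ S).ncard : ℝ)) →
      (DiEmbed.unlooped F \ S = ∅ ∨
        2 * (d : ℝ) ^ 3 * 4 ^ d + ω n < ((DiEmbed.unlooped F \ S).ncard : ℝ)) →
      1 - ε ≤ (DiEmbed.condLaw F S).real
        {a | ∃ g : V → V, DiEmbed.IsDiEmbedding F (DiEmbed.ofTable a) g ∧ ∀ u ∈ S, g u = u} := by
  obtain ⟨M, hM⟩ := DiEmbed.exists_forall_levels_mul_hallFailure_le_of_lt hε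
  obtain ⟨N, hN⟩ := eventually_atTop.1 (hω.eventually_ge_atTop M)
  refine ⟨N, fun V _ F S n d _ hn hd _ hloop hunloop => ?_⟩
  have hdeg : ∀ u, DiEmbed.nodeDegree F u ≤ d := hd ▸ DiEmbed.nodeDegree_le_degree F
  have hlarge : ∀ v ∉ S, 2 * (d : ℝ) ^ 3 * 4 ^ d + M < (DiEmbed.loopMates F S v).ncard := by
    intro v hv
    have hne : (DiEmbed.loopMates F S v).Nonempty := ⟨v, hv, Iff.rfl⟩
    refine (add_le_add_right (hN n hn) _).trans_lt ?_
    rcases DiEmbed.loopMates_eq_looped_or_unlooped F S v with hmates | hmates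
    · exact hmates ▸ hloop.resolve_left (hmates ▸ hne.ne_empty)
    · exact hmates ▸ hunloop.resolve_left (hmates ▸ hne.ne_empty)
  exact DiEmbed.one_sub_le_condLaw_real (P := DiEmbed.EmbedsFixing F S)
    (DiEmbed.isRare_admissible_not_embedsFixing
      (DiEmbed.isRare_agreesWith_not_embedsFixing hε hdeg fun v hv => hM d _ (hlarge v hv)))
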